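/- Let $2\le p\le\infty$, $1\le q\le\infty$, $R>0$, and let $\alpha$ satisfy $\alpha-1/p>1/2$. Fix an integer $A>\alpha$ and an $A$-regular, compactly supported, boundary-corrected (Cohen–Daubechies–Vial type) orthonormal wavelet basis $(\psi_{lk})_{l\ge l_0,\,k}$ of $L_2[0,1]$ (generating functions of class $C^A$ with compact support; wavelets with $A$ vanishing moments; the level $l_0$ consists of the $2^{l_0+1}$ father wavelets of scale $2^{l_0+1}$, and each level $l>l_0$ of $2^l$ wavelets). Let $$\mathcal B^{\alpha,R}_{p,q}=\Big\{f\in L_2[0,1]:\ \Big\|\Big(2^{l(\alpha+1/2-1/p)}\,\big\|(\langle f,\psi_{lk}\rangle)_k\big\|_{\ell_p}\Big)_{l\ge l_0}\Big\|_{\ell_q}\le R\Big\}.$$ Server $j\in\{1,\dots,m\}$ holds $n_j$ observations $(Y^{(j)}_i,X^{(j)}_i)$ with $X_i^{(j)}\sim U[0,1]$, $Y_i^{(j)}=f(X_i^{(j)})+\xi_i^{(j)}$ and $\xi_i^{(j)}\sim N(0,1)$ independent of $X_i^{(j)}$, all observations being independent. A distributed $(\boldsymbol\varepsilon,\boldsymbol\delta)$-DP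 protocol consists of, for each $j$, a transcript $T^{(j)}$ in a standard Borel space, drawn from a conditional law $K_j(\cdot\mid z)$ given the local data $z$ only, such that $K_j(B\mid z)\le e^{\varepsilon_j}K_j(B\mid z')+\delta_j$ for all measurable $B$ and all $z,z'\in(\mathbb R\times[0,1])^{n_j}$ differing in at most one observation, and of a measurable estimator $\hat f=\hat f(T^{(1)},\dots,T^{(m)})\in L_2[0,1]$. Let $\mathcal M(\boldsymbol\varepsilon,\boldsymbol\delta)$ be the class of these protocols. **Theorem (global lower bound).** Let $C_\varepsilon,C_\delta,\kappa>0$. There is a constant $c>0$, depending only on $\alpha,p,q,R$, the wavelet basis, $C_\varepsilon,C_\delta$ and $\kappa$, such that the following holds for all $m$, all $n_1,\dots,n_m$, all $0\le\varepsilon_j\le C_\varepsilon$ and all $\delta_j\ge0$. Let $D>0$ solve $$D^{2\alpha+2}=\sum_{j=1}^m (n_j^2\varepsilon_j^2)\wedge(n_jD),$$ and suppose that $\delta_j\le C_\delta\,\big(n_j^{1/2}\varepsilon_j^2(D\vee1)^{-1}\big)^{1+\kappa}$ for all $j$. Then $$\inf_{\hat f\in\mathcal M(\boldsymbol\varepsilon,\boldsymbol\delta)}\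 \sup_{f\in\mathcal B^{\alpha,R}_{p,q}}\mathbb E_f\|\hat f-f\|_2^2\ \ge\ c\,\big(D^{-2\alpha}\wedge1\big).$$ -/

import Mathlib

open MeasureTheory ProbabilityTheory
open scoped ENNReal

noncomputable section

namespace FederatedDP

/-! ### Function space and observations -/

/-- The Hilbert space `L₂[0,1]`. -/
abbrev L2 : Type := Lp ℝ 2 (volume : Measure unitInterval)

/-- A single observation `(Y, X)`: a real response and a covariate in `[0,1]`. -/
abbrev Obs : Type := ℝ × unitInterval

/-- The law `P_f` of one observation `(Y, X)`: `X` is uniform on `[0,1]`, the noise `ξ` is standard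
normal and independent of `X`, and `Y = f(X) + ξ`. -/
def obsLaw (f : L2) : Measure Obs :=
  ((volume : Measure unitInterval).prod (gaussianReal 0 1)).map (fun w => (f w.1 + w.2, w.1))

/-- The law of a local sample of `n` i.i.d. observations from `P_f`. -/
def sampleLaw (n : ℕ) (f : L2) : Measure (Fin n → Obs) :=
  Measure.pi (fun _ => obsLaw f)

/-! ### Distributed differentially private protocols -/

/-- `(ε, δ)`-differential privacy of a randomized transcript, given by its conditional law `K` given
the local data. Neighbouring data sets have Hamming distance at most one. -/
def IsDP {n : ℕ} {𝒯 : Type*} [MeasurableSpace 𝒯] (ε δ : ℝ) (K : Kernel (Fin n → Obs) 𝒯) : Prop :=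
  ∀ z z' : Fin n → Obs, hammingDist z z' ≤ 1 → ∀ B : Set 𝒯, MeasurableSet B →
    K z B ≤ ENNReal.ofReal (Real.exp ε) * K z' B + ENNReal.ofReal δ

universe u

/-- The class `M(ε, δ)` of distributed estimation protocols: server `j` holds `n j` observations
and outputs a transcript in a standard Borel space through an `(ε j, δ j)`-differentially
private channel that sees the local data only; the estimator is a measurable function of all the
transcripts with values in `L₂[0,1]`. -/
structure Protocol {m : ℕ} (n : Fin m → ℕ) (ε δ : Fin m → ℝ) where
  /-- The transcript spaces. -/
  Transcript : Fin m → Type u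
  [measurableSpace : ∀ j, MeasurableSpace (Transcript j)]
  [standardBorel : ∀ j, StandardBorelSpace (Transcript j)]
  /-- The conditional law of the transcript of server `j` given its local data. -/
  channel : ∀ j, Kernel (Fin (n j) → Obs) (Transcript j)
  [markov : ∀ j, IsMarkovKernel (channel j)]
  isDP : ∀ j, IsDP (ε j) (δ j) (channel j)
  /-- The estimator computed by the central server. -/
  estimator : (∀ j, Transcript j) → L2
  estimator_meas : StronglyMeasurable estimator

attribute [instance] Protocol.measurableSpace Protocol.standardBorel Protocol.markov

/-- The law of the vector of transcripts when the data are generated by `f`. The local samples are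
independent and each transcript depends on its own local sample only, so this is a product. -/
def Protocol.transcriptLaw {m : ℕ} {n : Fin m → ℕ} {ε δ : Fin m → ℝ} (P : Protocol.{u} n ε δ)
    (f : L2) : Measure (∀ j, P.Transcript j) :=
  Measure.pi (fun j => (sampleLaw (n j) f).bind (P.channel j))

/-- The integrated mean squared error `E_f ‖f̂ - f‖₂²`, a number in `[0, ∞]`. -/
def Protocol.risk {m : ℕ} {n : Fin m → ℕ} {ε δ : Fin m → ℝ} (P : Protocol.{u} n ε δ)
    (f : L2) : ℝ≥0∞ :=
  ∫⁻ t, ‖P.estimator t - f‖ₑ ^ 2 ∂(P.transcriptLaw f)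

/-! ### Wavelet bases of `L₂[0,1]` and Besov balls -/

/-- The functions that generate, by dilation and translation, the functions of one scale of a
boundary-corrected wavelet system on `[0,1]`: one function for the interior, finitely many for the
left endpoint and finitely many for the right endpoint. -/
structure Generators where
  /-- The interior function (father or mother wavelet). -/
  inner : ℝ → ℝ
  /-- The number of functions at the left endpoint. -/
  numLeft : ℕ
  /-- The number of functions at the right endpoint. -/
  numRight : ℕ
  /-- The functions at the left endpoint. -/
  left : Fin numLeft → ℝ → ℝ
  /-- The functions at the right endpoint, as functions of the distance to that endpoint. -/
  right : Fin numRight → ℝ → ℝ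

/-- The `k`-th function at scale `2^l`: `2^{l/2} g(2^l x - k)` in the interior, and
`2^{l/2} g_k(2^l x)` and `2^{l/2} g_{k'}(2^l (1 - x))` at the left and at the right endpoint,
with `k' = 2^l - 1 - k`. -/
def Generators.dilate (g : Generators) (l k : ℕ) (x : ℝ) : ℝ :=
  (2 : ℝ) ^ ((l : ℝ) / 2) *
    (if h : k < g.numLeft then g.left ⟨k, h⟩ (2 ^ l * x)
     else if h' : 2 ^ l - 1 - k < g.numRight then g.right ⟨2 ^ l - 1 - k, h'⟩ (2 ^ l * (1 - x))
     else g.inner (2 ^ l * x - k))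

/-- A property holds for all the generating functions. -/
def Generators.All (g : Generators) (Q : (ℝ → ℝ) → Prop) : Prop :=
  Q g.inner ∧ (∀ i, Q (g.left i)) ∧ ∀ i, Q (g.right i)

/-- The number of basis functions at level `l`. The level `l₀` carries the `2^(l₀+1)` father
wavelets of scale `2^(l₀+1)`, and each level `l > l₀` carries `2^l` wavelets. -/
def levelSize (l₀ l : ℕ) : ℕ :=
  if l < l₀ then 0 else if l = l₀ then 2 ^ (l₀ + 1) else 2 ^ l

/-- The functions `ψ_{lk}`, with the convention `ψ_{l₀ k} = φ_{l₀+1, k}`. -/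
def waveletFun (father mother : Generators) (l₀ l k : ℕ) (x : ℝ) : ℝ :=
  if l = l₀ then father.dilate (l₀ + 1) k x else mother.dilate l k x

/-- An `A`-regular, compactly supported, orthonormal wavelet basis of `L₂[0,1]` of
Cohen–Daubechies–Vial type: the generating functions are `A` times continuously differentiable
with compact support, the wavelets have `A` vanishing moments on `[0,1]`, and the functions
`ψ_{lk}` form an orthonormal basis of `L₂[0,1]`. -/
structure WaveletBasis (A : ℕ) where
  /-- The coarsest level. -/
  l₀ : ℕ
  /-- The father wavelet with its boundary corrections. -/
  father : Generators
  /-- The mother wavelet with its boundary corrections. -/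
  mother : Generators
  father_edge : father.numLeft + father.numRight ≤ 2 ^ (l₀ + 1)
  mother_edge : mother.numLeft + mother.numRight ≤ 2 ^ (l₀ + 1)
  father_smooth : father.All (fun g => ContDiff ℝ A g)
  mother_smooth : mother.All (fun g => ContDiff ℝ A g)
  father_support : father.All HasCompactSupport
  mother_support : mother.All HasCompactSupport
  /-- The orthonormal basis of `L₂[0,1]` formed by the `ψ_{lk}`. -/
  basis : HilbertBasis (Σ l, Fin (levelSize l₀ l)) ℝ L2
  basis_ae : ∀ (l : ℕ) (k : Fin (levelSize l₀ l)),
    (basis ⟨l, k⟩ : unitInterval → ℝ) =ᵐ[volume]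
      fun x => waveletFun father mother l₀ l k x
  vanishing_moments : ∀ (l : ℕ) (k : Fin (levelSize l₀ l)), l₀ < l → ∀ i < A,
    ∫ x : unitInterval, (x : ℝ) ^ i * waveletFun father mother l₀ l k x = 0

/-- The wavelet coefficient `f_{lk} = ⟨f, ψ_{lk}⟩`. -/
def WaveletBasis.coeff {A : ℕ} (W : WaveletBasis A) (f : L2) (l : ℕ)
    (k : Fin (levelSize W.l₀ l)) : ℝ :=
  inner ℝ (W.basis ⟨l, k⟩) f

/-- The `ℓ_q` norm of a family of numbers in `[0, ∞]`, for `0 < q ≤ ∞`. -/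
def lqNorm {ι : Type*} (q : ℝ≥0∞) (a : ι → ℝ≥0∞) : ℝ≥0∞ :=
  if q = ∞ then ⨆ i, a i else (∑' i, a i ^ q.toReal) ^ (1 / q.toReal)

/-- The Besov norm: the `ℓ_q` norm over the levels `l ≥ l₀` of
`2^{l(α + 1/2 - 1/p)} ‖(f_{lk})_k‖_p`. (There are no coefficients at the levels `l < l₀`, which
contribute zero.) -/
def WaveletBasis.besovNorm {A : ℕ} (W : WaveletBasis A) (α : ℝ) (p q : ℝ≥0∞) (f : L2) : ℝ≥0∞ :=
  lqNorm q (fun l : ℕ => ENNReal.ofReal ((2 : ℝ) ^ ((l : ℝ) * (α + 1 / 2 - (p⁻¹).toReal))) *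
    lqNorm p (fun k : Fin (levelSize W.l₀ l) => ‖W.coeff f l k‖ₑ))

/-- The closed Besov ball of radius `R`. -/
def WaveletBasis.besovBall {A : ℕ} (W : WaveletBasis A) (α : ℝ) (p q : ℝ≥0∞) (R : ℝ) : Set L2 :=
  {f | W.besovNorm α p q f ≤ ENNReal.ofReal R}

/-- The global minimax risk over a class `F` of regression functions: the infimum over all
distributed `(ε, δ)`-differentially private protocols of the worst-case risk. -/
def globalMinimaxRisk {m : ℕ} (n : Fin m → ℕ) (ε δ : Fin m → ℝ) (F : Set L2) : ℝ≥0∞ :=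
  ⨅ P : Protocol.{u} n ε δ, ⨆ f ∈ F, P.risk f

end FederatedDP

end

/-!
The lower bound follows from Assouad's lemma for the perturbations `∑ ± h ψ_{Lk}` of the zero
function by all the wavelets of one level `L`, with `2 ^ L` of order `max D 1` and `h` of order
`2 ^ (-L (α + 1 / 2))`. By `Protocol.le_iSup_risk` it is enough that the laws of all the transcripts
at two neighbouring vertices are at bounded Hellinger distance; then each of the `2 ^ L`
coefficients costs a risk of order `h²`. The squared Hellinger distance is subadditive over the
servers (`HellingerSqLE.pi`), so what has to be shown is that server `j` contributes at most
`C h² min (n_j² ε_j² / 2 ^ L) n_j`, which is `exists_hellingerSqLE_server`.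

The likelihood ratio of a whole sample under the two vertices may be far from one, even where
privacy makes the transcript uninformative. The segment between the vertices is therefore cut into
short steps, and the bounds for the steps are added up in the Hellinger metric
(`HellingerSqLE.of_chain`). For one step, with transcript laws `P₀`, `P₁` of densities `p₀`, `p₁`,
the squared Hellinger distance is at most `Δ = ∫ φ dP₁ - ∫ φ dP₀` for
`φ = (p₁ - p₀) / (p₁ + p₀)`, and `Δ` is the expectation of `(Z - 1) φ` at the starting point, for
`Z` the likelihood ratio of the sample. Since `E φ² ≤ Δ`, this gives `Δ ≤ E (Z - 1)²`, the bound
that ignores privacy (`discriminationLE_of_integral_sq`). Under privacy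
(`discriminationLE_of_isDP`), `Z - 1` is a telescoping sum over the `n` observations, and in each
term the observation may be resampled at the price `e ^ ε - 1`, so that the term is at most of the
order `(e ^ ε - 1) E|l - 1| √Δ`, where `l` is the likelihood ratio of one observation. As a wavelet
is localized to an interval of length of order `2 ^ (-L)`, the factor `E|l - 1|` is of the order
`2 ^ (-L / 2)` times the length of the step, and solving for `Δ` gives `n² ε² / 2 ^ L` times the
squared length. The term `δ` of the privacy constraint acts on a truncation of `φ`; the part cut off
is controlled by high moments of `φ`, which are bounded by those of `Z - 1`, and the exponent
`1 + κ` in the condition on `δ` leaves room for both.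
-/


noncomputable section

namespace FederatedDP

/-! ### Hellinger distance -/

section Hellinger

variable {𝒯 : Type*} [MeasurableSpace 𝒯]

/-- The squared Hellinger distance `∫ (√p - √q)²` of `P` and `Q` is at most `r`. The square roots
`a`, `b` of the densities with respect to some finite dominating measure are part of the data, which
spares the proof that the distance does not depend on the dominating measure. -/
def HellingerSqLE (P Q : Measure 𝒯) (r : ℝ) : Prop :=
  ∃ (μ : Measure 𝒯) (_ : IsFiniteMeasure μ) (a b : 𝒯 → ℝ), Measurable a ∧ Measurable b ∧
    (∀ t, 0 ≤ a t) ∧ (∀ t, 0 ≤ b t) ∧ P = μ.withDensity (fun t => ENNReal.ofReal (a t ^ 2)) ∧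
    Q = μ.withDensity (fun t => ENNReal.ofReal (b t ^ 2)) ∧ ∫ t, (a t - b t) ^ 2 ∂μ ≤ r

lemma HellingerSqLE.mono {P Q : Measure 𝒯} {r r' : ℝ} (h : HellingerSqLE P Q r) (hr : r ≤ r') :
    HellingerSqLE P Q r' := by
  obtain ⟨μ, h0, a, b, h1, h2, h3, h4, h5, h6, h7⟩ := h
  exact ⟨μ, h0, a, b, h1, h2, h3, h4, h5, h6, h7.trans hr⟩

lemma integrable_and_integral_of_withDensity_ofReal {μ : Measure 𝒯} {g : 𝒯 → ℝ}
    (hg : Measurable g) (h0 : ∀ t, 0 ≤ g t)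
    [hP : IsProbabilityMeasure (μ.withDensity (fun t => ENNReal.ofReal (g t)))] :
    Integrable g μ ∧ ∫ t, g t ∂μ = 1 := by
  have h1 : ∫⁻ t, ENNReal.ofReal (g t) ∂μ = 1 := by
    have := hP.measure_univ
    rwa [withDensity_apply _ MeasurableSet.univ, Measure.restrict_univ] at this
  have hi : Integrable g μ := by
    refine ⟨hg.aestronglyMeasurable, ?_⟩
    rw [hasFiniteIntegral_iff_ofReal (Filter.Eventually.of_forall h0), h1]
    exact ENNReal.one_lt_top
  refine ⟨hi, ?_⟩
  rw [integral_eq_lintegral_of_nonneg_ae (Filter.Eventually.of_forall h0) hg.aestronglyMeasurable,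
    h1, ENNReal.toReal_one]

lemma integrable_mul_of_sq {μ : Measure 𝒯} {a b : 𝒯 → ℝ} (ha : Measurable a) (hb : Measurable b)
    (ha2 : Integrable (fun t => a t ^ 2) μ) (hb2 : Integrable (fun t => b t ^ 2) μ) :
    Integrable (fun t => a t * b t) μ := by
  refine (ha2.add hb2).mono' (ha.mul hb).aestronglyMeasurable (Filter.Eventually.of_forall ?_)
  intro t
  simp only [Pi.add_apply, Real.norm_eq_abs, abs_le]
  constructor <;> nlinarith [sq_nonneg (a t + b t), sq_nonneg (a t - b t)]

lemma ofReal_integral_le_lintegral_ofReal {μ : Measure 𝒯} {g : 𝒯 → ℝ} (hg : Integrable g μ) :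
    ENNReal.ofReal (∫ t, g t ∂μ) ≤ ∫⁻ t, ENNReal.ofReal (g t) ∂μ := by
  have h1 : ∫ t, g t ∂μ ≤ ∫ t, max (g t) 0 ∂μ :=
    integral_mono hg hg.pos_part fun t => le_max_left _ _
  refine (ENNReal.ofReal_le_ofReal h1).trans ?_
  rw [ofReal_integral_eq_lintegral_ofReal hg.pos_part
    (Filter.Eventually.of_forall fun t => le_max_right _ _)]
  refine lintegral_mono fun t => ?_
  simp

/-- Two hypotheses that are close in Hellinger distance cannot be told apart: Le Cam's bound for the
sum of the two quadratic risks of estimating a parameter that is `h` under `P` and `-h` under `Q`. -/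
lemma HellingerSqLE.two_point {P Q : Measure 𝒯} [IsProbabilityMeasure P] [IsProbabilityMeasure Q]
    {r : ℝ} (hPQ : HellingerSqLE P Q r) {g : 𝒯 → ℝ} (hg : Measurable g) (h : ℝ) :
    ENNReal.ofReal (h ^ 2 * (4 - 3 * r) / 4) ≤
      ∫⁻ t, ENNReal.ofReal ((g t - h) ^ 2) ∂P + ∫⁻ t, ENNReal.ofReal ((g t + h) ^ 2) ∂Q := by
  obtain ⟨μ, _, a, b, ha, hb, ha0, hb0, rfl, rfl, hr⟩ := hPQ
  obtain ⟨hai, ha1⟩ := integrable_and_integral_of_withDensity_ofReal (μ := μ)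
    (g := fun t => a t ^ 2) (ha.pow_const 2) (fun t => sq_nonneg (a t))
  obtain ⟨hbi, hb1⟩ := integrable_and_integral_of_withDensity_ofReal (μ := μ)
    (g := fun t => b t ^ 2) (hb.pow_const 2) (fun t => sq_nonneg (b t))
  have hab := integrable_mul_of_sq ha hb hai hbi
  have hdi : Integrable (fun t => (a t - b t) ^ 2) μ := by
    refine ((hai.add hbi).sub (hab.const_mul 2)).congr (Filter.Eventually.of_forall fun t => ?_)
    simp only [Pi.add_apply, Pi.sub_apply]; ring
  rw [lintegral_withDensity_eq_lintegral_mul _ (by fun_prop) (by fun_prop),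
    lintegral_withDensity_eq_lintegral_mul _ (by fun_prop) (by fun_prop),
    ← lintegral_add_left (by fun_prop)]
  have hsi : Integrable (fun t => a t ^ 2 + b t ^ 2) μ := hai.add hbi
  have key : ∀ t, h ^ 2 / 4 * (2 * (a t ^ 2 + b t ^ 2) - 3 * (a t - b t) ^ 2) ≤
      a t ^ 2 * (g t - h) ^ 2 + b t ^ 2 * (g t + h) ^ 2 := by
    intro t
    have h1 : 2 * (a t ^ 2 + b t ^ 2) - 3 * (a t - b t) ^ 2 ≤ 8 * min (a t ^ 2) (b t ^ 2) := by
      rcases le_total (a t) (b t) with hl | hl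
      · rw [min_eq_left (by gcongr; exact ha0 t)]; nlinarith [sq_nonneg (3 * a t - b t)]
      · rw [min_eq_right (by gcongr; exact hb0 t)]; nlinarith [sq_nonneg (3 * b t - a t)]
    have h2 : min (a t ^ 2) (b t ^ 2) * ((g t - h) ^ 2 + (g t + h) ^ 2) ≤
        a t ^ 2 * (g t - h) ^ 2 + b t ^ 2 * (g t + h) ^ 2 := by
      rw [mul_add]; gcongr
      · exact min_le_left _ _
      · exact min_le_right _ _
    have h3 : 0 ≤ min (a t ^ 2) (b t ^ 2) := le_min (sq_nonneg _) (sq_nonneg _)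
    nlinarith [mul_nonneg h3 (sq_nonneg (g t)), mul_le_mul_of_nonneg_left h1 (sq_nonneg h)]
  have hint : h ^ 2 * (4 - 3 * r) / 4 ≤
      ∫ t, h ^ 2 / 4 * (2 * (a t ^ 2 + b t ^ 2) - 3 * (a t - b t) ^ 2) ∂μ := by
    rw [integral_const_mul, integral_sub (hsi.const_mul 2) (hdi.const_mul 3),
      integral_const_mul, integral_const_mul, integral_add hai hbi, ha1, hb1]
    nlinarith [sq_nonneg h]
  refine (ENNReal.ofReal_le_ofReal hint).trans ?_
  refine (ofReal_integral_le_lintegral_ofReal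
    (((hsi.const_mul 2).sub (hdi.const_mul 3)).const_mul _)).trans ?_
  refine lintegral_mono fun t => ?_
  refine (ENNReal.ofReal_le_ofReal (key t)).trans ?_
  simp only [Pi.mul_apply]
  rw [ENNReal.ofReal_add (by positivity) (by positivity), ENNReal.ofReal_mul (sq_nonneg _),
    ENNReal.ofReal_mul (sq_nonneg _)]

lemma pi_withDensity_ofReal {ι : Type*} [Fintype ι] {𝒳 : ι → Type*}
    [∀ i, MeasurableSpace (𝒳 i)] (μ : ∀ i, Measure (𝒳 i)) [∀ i, IsFiniteMeasure (μ i)]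
    (g : ∀ i, 𝒳 i → ℝ) (h0 : ∀ i x, 0 ≤ g i x) (hi : ∀ i, Integrable (g i) (μ i)) :
    Measure.pi (fun i => (μ i).withDensity (fun x => ENNReal.ofReal (g i x))) =
      (Measure.pi μ).withDensity (fun x => ENNReal.ofReal (∏ i, g i (x i))) := by
  have hfin : ∀ i, IsFiniteMeasure ((μ i).withDensity (fun x => ENNReal.ofReal (g i x))) :=
    fun i => isFiniteMeasure_withDensity_ofReal (hi i).2
  refine Measure.pi_eq (μ := fun i => (μ i).withDensity (fun x => ENNReal.ofReal (g i x)))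
    fun s hs => ?_
  have hbox : ∀ x : ∀ i, 𝒳 i, (Set.pi Set.univ s).indicator
      (fun x => ENNReal.ofReal (∏ i, g i (x i))) x =
      ENNReal.ofReal (∏ i, (s i).indicator (g i) (x i)) := by
    intro x
    by_cases hx : x ∈ Set.pi Set.univ s
    · rw [Set.indicator_of_mem hx]
      congr 1
      exact Finset.prod_congr rfl fun i _ => (Set.indicator_of_mem (hx i trivial) _).symm
    · rw [Set.indicator_of_notMem hx]
      simp only [Set.mem_pi, Set.mem_univ, true_imp_iff, not_forall] at hx
      obtain ⟨i, hxi⟩ := hx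
      rw [Finset.prod_eq_zero (Finset.mem_univ i) (Set.indicator_of_notMem hxi _),
        ENNReal.ofReal_zero]
  have hsi : ∀ i, Integrable ((s i).indicator (g i)) (μ i) := fun i => (hi i).indicator (hs i)
  have hs0 : ∀ i x, 0 ≤ (s i).indicator (g i) x :=
    fun i x => Set.indicator_nonneg (fun y _ => h0 i y) x
  rw [withDensity_apply _ (MeasurableSet.univ_pi hs),
    ← lintegral_indicator (MeasurableSet.univ_pi hs)]
  simp_rw [hbox]
  rw [← ofReal_integral_eq_lintegral_ofReal (Integrable.fintype_prod_dep hsi)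
    (Filter.Eventually.of_forall fun x => Finset.prod_nonneg fun i _ => hs0 i _),
    integral_fintype_prod_eq_prod (fun i => (s i).indicator (g i)),
    ENNReal.ofReal_prod_of_nonneg fun i _ => integral_nonneg (hs0 i)]
  refine Finset.prod_congr rfl fun i _ => ?_
  rw [ofReal_integral_eq_lintegral_ofReal (hsi i) (Filter.Eventually.of_forall (hs0 i)),
    withDensity_apply _ (hs i), ← lintegral_indicator (hs i)]
  refine lintegral_congr fun x => ?_
  by_cases hx : x ∈ s i <;> simp [hx]

lemma one_sub_prod_le_sum_one_sub {ι : Type*} (s : Finset ι) {x : ι → ℝ} (h0 : ∀ i, 0 ≤ x i)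
    (h1 : ∀ i, x i ≤ 1) : 1 - ∏ i ∈ s, x i ≤ ∑ i ∈ s, (1 - x i) := by
  classical
  induction s using Finset.induction_on with
  | empty => simp
  | insert i s his ih =>
    rw [Finset.prod_insert his, Finset.sum_insert his]
    have h2 : ∏ j ∈ s, x j ≤ 1 := Finset.prod_le_one (fun j _ => h0 j) fun j _ => h1 j
    nlinarith [h0 i, h1 i]

/-- The squared Hellinger distance is subadditive over product measures. -/
lemma HellingerSqLE.pi {ι : Type*} [Fintype ι] {𝒳 : ι → Type*} [∀ i, MeasurableSpace (𝒳 i)]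
    {P Q : ∀ i, Measure (𝒳 i)} [∀ i, IsProbabilityMeasure (P i)] [∀ i, IsProbabilityMeasure (Q i)]
    {r : ι → ℝ} (h : ∀ i, HellingerSqLE (P i) (Q i) (r i)) :
    HellingerSqLE (Measure.pi P) (Measure.pi Q) (∑ i, r i) := by
  choose μ hμ a b ha hb ha0 hb0 hP hQ hr using h
  have hA : ∀ i, Integrable (fun x => a i x ^ 2) (μ i) ∧ ∫ x, a i x ^ 2 ∂(μ i) = 1 := fun i => by
    have : IsProbabilityMeasure ((μ i).withDensity fun x => ENNReal.ofReal (a i x ^ 2)) :=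
      hP i ▸ inferInstance
    exact integrable_and_integral_of_withDensity_ofReal ((ha i).pow_const 2) fun x => sq_nonneg _
  have hB : ∀ i, Integrable (fun x => b i x ^ 2) (μ i) ∧ ∫ x, b i x ^ 2 ∂(μ i) = 1 := fun i => by
    have : IsProbabilityMeasure ((μ i).withDensity fun x => ENNReal.ofReal (b i x ^ 2)) :=
      hQ i ▸ inferInstance
    exact integrable_and_integral_of_withDensity_ofReal ((hb i).pow_const 2) fun x => sq_nonneg _
  have hAB : ∀ i, Integrable (fun x => a i x * b i x) (μ i) := fun i =>
    integrable_mul_of_sq (ha i) (hb i) (hA i).1 (hB i).1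
  refine ⟨Measure.pi μ, inferInstance, fun x => ∏ i, a i (x i), fun x => ∏ i, b i (x i),
    by fun_prop, by fun_prop, fun x => Finset.prod_nonneg fun i _ => ha0 i _,
    fun x => Finset.prod_nonneg fun i _ => hb0 i _, ?_, ?_, ?_⟩
  · simp_rw [← Finset.prod_pow]
    rw [← pi_withDensity_ofReal μ (fun i x => a i x ^ 2) (fun i x => sq_nonneg _) fun i => (hA i).1]
    congr 1; ext1 i; exact hP i
  · simp_rw [← Finset.prod_pow]
    rw [← pi_withDensity_ofReal μ (fun i x => b i x ^ 2) (fun i x => sq_nonneg _) fun i => (hB i).1]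
    congr 1; ext1 i; exact hQ i
  · have hexp : ∀ x : ∀ i, 𝒳 i, (∏ i, a i (x i) - ∏ i, b i (x i)) ^ 2 =
        (∏ i, a i (x i) ^ 2 + ∏ i, b i (x i) ^ 2) - 2 * ∏ i, (a i (x i) * b i (x i)) := by
      intro x
      rw [Finset.prod_pow, Finset.prod_pow, Finset.prod_mul_distrib]; ring
    have e1 := integral_fintype_prod_eq_prod (μ := μ) (fun i x => a i x ^ 2)
    have e2 := integral_fintype_prod_eq_prod (μ := μ) (fun i x => b i x ^ 2)
    have e3 := integral_fintype_prod_eq_prod (μ := μ) (fun i x => a i x * b i x)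
    have i1 := Integrable.fintype_prod_dep (fun i => (hA i).1)
    have i2 := Integrable.fintype_prod_dep (fun i => (hB i).1)
    have i3 := Integrable.fintype_prod_dep hAB
    have i12 : Integrable (fun x : ∀ i, 𝒳 i => ∏ i, a i (x i) ^ 2 + ∏ i, b i (x i) ^ 2)
      (Measure.pi μ) := i1.add i2
    simp_rw [hexp]
    rw [integral_sub i12 (i3.const_mul 2), integral_add i1 i2, integral_const_mul, e1, e2,
      e3, Finset.prod_congr rfl fun i _ => (hA i).2, Finset.prod_congr rfl fun i _ => (hB i).2]
    have hd : ∀ i, ∫ x, (a i x - b i x) ^ 2 ∂(μ i) = 2 - 2 * ∫ x, a i x * b i x ∂(μ i) := by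
      intro i
      have : ∀ x, (a i x - b i x) ^ 2 = (a i x ^ 2 + b i x ^ 2) - 2 * (a i x * b i x) :=
        fun x => by ring
      have hs : Integrable (fun x => a i x ^ 2 + b i x ^ 2) (μ i) := (hA i).1.add (hB i).1
      simp_rw [this]
      rw [integral_sub hs ((hAB i).const_mul 2),
        integral_add (hA i).1 (hB i).1, integral_const_mul, (hA i).2, (hB i).2]
      norm_num
    have h1 : ∀ i, ∫ x, a i x * b i x ∂(μ i) ≤ 1 := fun i => by
      have := integral_nonneg (μ := μ i) (f := fun x => (a i x - b i x) ^ 2) fun x => sq_nonneg _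
      rw [hd i] at this; linarith
    have h0 : ∀ i, 0 ≤ ∫ x, a i x * b i x ∂(μ i) := fun i =>
      integral_nonneg fun x => mul_nonneg (ha0 i x) (hb0 i x)
    have hsum : ∑ i, (1 - ∫ x, a i x * b i x ∂(μ i)) ≤ ∑ i, r i / 2 :=
      Finset.sum_le_sum fun i _ => by have := hr i; rw [hd i] at this; linarith
    rw [← Finset.sum_div] at hsum
    have := one_sub_prod_le_sum_one_sub Finset.univ h0 h1
    simp only [Finset.prod_const_one]
    linarith

/-- Dual form of the triangular discrimination `∫ (q - p)² / (q + p) ≤ r` of two laws with densities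
`p` and `q`, as a statement about bounded test functions. It is used with `φ = (q - p) / (q + p)`,
for which the inequalities between moments hold. -/
def DiscriminationLE (P Q : Measure 𝒯) (r : ℝ) : Prop :=
  ∀ φ : 𝒯 → ℝ, Measurable φ → (∀ t, |φ t| ≤ 1) →
    (∀ s : ℕ, ∫ t, φ t ^ (2 * s + 2) ∂P ≤ ∫ t, φ t ^ (2 * s + 1) ∂Q - ∫ t, φ t ^ (2 * s + 1) ∂P) →
    ∫ t, φ t ∂Q - ∫ t, φ t ∂P ≤ r

lemma integral_withDensity_ofReal {μ : Measure 𝒯} {p : 𝒯 → ℝ} (hp : Measurable p)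
    (h0 : ∀ t, 0 ≤ p t) (g : 𝒯 → ℝ) :
    ∫ t, g t ∂(μ.withDensity fun t => ENNReal.ofReal (p t)) = ∫ t, p t * g t ∂μ := by
  rw [integral_withDensity_eq_integral_toReal_smul (by fun_prop)
    (Filter.Eventually.of_forall fun t => ENNReal.ofReal_lt_top)]
  refine integral_congr_ae (Filter.Eventually.of_forall fun t => ?_)
  simp [ENNReal.toReal_ofReal (h0 t)]

/-- The squared Hellinger distance is at most the triangular discrimination. -/
lemma DiscriminationLE.integral_sq_sub_le {μ : Measure 𝒯} {a b : 𝒯 → ℝ} (ha : Measurable a)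
    (hb : Measurable b) (ha0 : ∀ t, 0 ≤ a t) (hb0 : ∀ t, 0 ≤ b t)
    (hai : Integrable (fun t => a t ^ 2) μ) (hbi : Integrable (fun t => b t ^ 2) μ) {r : ℝ}
    (h : DiscriminationLE (μ.withDensity fun t => ENNReal.ofReal (a t ^ 2))
      (μ.withDensity fun t => ENNReal.ofReal (b t ^ 2)) r) :
    ∫ t, (a t - b t) ^ 2 ∂μ ≤ r := by
  set φ : 𝒯 → ℝ := fun t => (b t ^ 2 - a t ^ 2) / (b t ^ 2 + a t ^ 2) with hφ
  have hφm : Measurable φ := by fun_prop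
  have hφ1 : ∀ t, |φ t| ≤ 1 := fun t => by
    rw [hφ]; simp only
    rw [abs_div]
    refine div_le_one_of_le₀ ?_ (abs_nonneg _)
    rw [abs_of_nonneg (by positivity : 0 ≤ b t ^ 2 + a t ^ 2), abs_le]
    constructor <;> nlinarith [sq_nonneg (a t), sq_nonneg (b t)]
  have hmul : ∀ t, (b t ^ 2 + a t ^ 2) * φ t = b t ^ 2 - a t ^ 2 := fun t => by
    rcases eq_or_ne (b t ^ 2 + a t ^ 2) 0 with h0 | h0
    · have h1 : a t ^ 2 = 0 := by nlinarith [sq_nonneg (a t), sq_nonneg (b t)]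
      have h2 : b t ^ 2 = 0 := by nlinarith [sq_nonneg (a t), sq_nonneg (b t)]
      simp [h1, h2]
    · rw [hφ]; field_simp
  have hbd : ∀ k : ℕ, ∀ t, ‖φ t ^ k‖ ≤ 1 := fun k t => by
    rw [norm_pow, Real.norm_eq_abs]; exact pow_le_one₀ (abs_nonneg _) (hφ1 t)
  have hia : ∀ k : ℕ, Integrable (fun t => a t ^ 2 * φ t ^ k) μ := fun k =>
    hai.mul_bdd (hφm.pow_const k).aestronglyMeasurable (Filter.Eventually.of_forall (hbd k))
  have hib : ∀ k : ℕ, Integrable (fun t => b t ^ 2 * φ t ^ k) μ := fun k =>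
    hbi.mul_bdd (hφm.pow_const k).aestronglyMeasurable (Filter.Eventually.of_forall (hbd k))
  have ea := fun g => integral_withDensity_ofReal (μ := μ) (ha.pow_const 2)
    (fun t => sq_nonneg (a t)) g
  have eb := fun g => integral_withDensity_ofReal (μ := μ) (hb.pow_const 2)
    (fun t => sq_nonneg (b t)) g
  have hmain := h φ hφm hφ1 fun s => by
    rw [ea, ea, eb, ← integral_sub (hib _) (hia _)]
    refine integral_mono (hia _) ((hib _).sub (hia _)) fun t => ?_
    have : b t ^ 2 * φ t ^ (2 * s + 1) - a t ^ 2 * φ t ^ (2 * s + 1) =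
        (b t ^ 2 + a t ^ 2) * φ t ^ (2 * s + 2) := by
      rw [← sub_mul, ← hmul t]; ring
    rw [this]
    have h2 : 0 ≤ φ t ^ (2 * s + 2) := Even.pow_nonneg ⟨s + 1, by ring⟩ _
    nlinarith [sq_nonneg (b t)]
  refine le_trans ?_ hmain
  rw [ea, eb]
  have hia1 := hia 1
  have hib1 := hib 1
  simp only [pow_one] at hia1 hib1
  rw [← integral_sub hib1 hia1]
  refine integral_mono_of_nonneg (Filter.Eventually.of_forall fun t => sq_nonneg _)
    (hib1.sub hia1) (Filter.Eventually.of_forall fun t => ?_)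
  -- `(a - b)² ≤ (a² - b²)² / (a² + b²)` because `a² + b² ≤ (a + b)²`
  have e : b t ^ 2 * φ t - a t ^ 2 * φ t = (b t ^ 2 - a t ^ 2) * φ t := by ring
  show (a t - b t) ^ 2 ≤ b t ^ 2 * φ t - a t ^ 2 * φ t
  rw [e]
  rcases eq_or_ne (b t ^ 2 + a t ^ 2) 0 with h0 | h0
  · have h1 : a t = 0 := by nlinarith [sq_nonneg (a t), sq_nonneg (b t)]
    have h2 : b t = 0 := by nlinarith [sq_nonneg (a t), sq_nonneg (b t)]
    simp [h1, h2]
  · have hpos : 0 < b t ^ 2 + a t ^ 2 := lt_of_le_of_ne (by positivity) (Ne.symm h0)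
    rw [hφ]; simp only
    rw [mul_div_assoc', le_div_iff₀ hpos]
    have : (b t ^ 2 - a t ^ 2) * (b t ^ 2 - a t ^ 2) = (a t - b t) ^ 2 * (a t + b t) ^ 2 := by ring
    rw [this]
    gcongr
    nlinarith [mul_nonneg (ha0 t) (hb0 t)]

/-- A chain of `N` laws whose consecutive discriminations are at most `r` has its ends at squared
Hellinger distance at most `N² r`. -/
lemma HellingerSqLE.of_chain {P : ℕ → Measure 𝒯} [∀ i, IsProbabilityMeasure (P i)] {N : ℕ} {r : ℝ}
    (h : ∀ i < N, DiscriminationLE (P i) (P (i + 1)) r) :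
    HellingerSqLE (P 0) (P N) (N ^ 2 * r) := by
  -- the densities are taken with respect to the sum of all the laws of the chain
  set μ : Measure 𝒯 := ∑ i ∈ Finset.range (N + 1), P i with hμ
  have hle : ∀ i < N + 1, P i ≤ μ := fun i hi => by
    rw [hμ]
    exact Finset.single_le_sum (f := P) (fun _ _ => Measure.zero_le _) (Finset.mem_range.2 hi)
  have hfin : IsFiniteMeasure μ := by rw [hμ]; infer_instance
  set a : ℕ → 𝒯 → ℝ := fun i t => √((P i).rnDeriv μ t).toReal with ha
  have ham : ∀ i, Measurable (a i) := fun i =>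
    ((Measure.measurable_rnDeriv _ _).ennreal_toReal).sqrt
  have ha0 : ∀ i t, 0 ≤ a i t := fun i t => Real.sqrt_nonneg _
  have hP : ∀ i < N + 1, P i = μ.withDensity (fun t => ENNReal.ofReal (a i t ^ 2)) := by
    intro i hi
    conv_lhs => rw [← Measure.withDensity_rnDeriv_eq (P i) μ (hle i hi).absolutelyContinuous]
    refine withDensity_congr_ae ?_
    filter_upwards [Measure.rnDeriv_lt_top (P i) μ] with t ht
    rw [ha]; simp only
    rw [Real.sq_sqrt ENNReal.toReal_nonneg, ENNReal.ofReal_toReal ht.ne]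
  have hint : ∀ i < N + 1, Integrable (fun t => a i t ^ 2) μ := fun i hi => by
    have : IsProbabilityMeasure (μ.withDensity (fun t => ENNReal.ofReal (a i t ^ 2))) :=
      hP i hi ▸ inferInstance
    exact (integrable_and_integral_of_withDensity_ofReal ((ham i).pow_const 2)
      fun t => sq_nonneg _).1
  have hstep : ∀ i ∈ Finset.range N, ∫ t, (a (i + 1) t - a i t) ^ 2 ∂μ ≤ r := fun i hi => by
    rw [Finset.mem_range] at hi
    have h1 := h i hi
    rw [hP i (by omega), hP (i + 1) (by omega)] at h1
    refine le_trans (le_of_eq ?_) (h1.integral_sq_sub_le (ham _) (ham _) (ha0 _) (ha0 _)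
      (hint i (by omega)) (hint (i + 1) (by omega)))
    exact integral_congr_ae (Filter.Eventually.of_forall fun t => by simp only; ring)
  have hsqi : ∀ i ∈ Finset.range N, Integrable (fun t => (a (i + 1) t - a i t) ^ 2) μ := by
    intro i hi
    rw [Finset.mem_range] at hi
    have i1 := hint i (by omega)
    have i2 := hint (i + 1) (by omega)
    refine ((i2.add i1).sub ((integrable_mul_of_sq (ham _) (ham _) i2 i1).const_mul 2)).congr
      (Filter.Eventually.of_forall fun t => ?_)
    simp only [Pi.add_apply, Pi.sub_apply]; ring
  refine ⟨μ, hfin, a 0, a N, ham 0, ham N, ha0 0, ha0 N, hP 0 (by omega), hP N (by omega), ?_⟩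
  calc ∫ t, (a 0 t - a N t) ^ 2 ∂μ
      ≤ ∫ t, N * ∑ i ∈ Finset.range N, (a (i + 1) t - a i t) ^ 2 ∂μ := by
        refine integral_mono_of_nonneg (Filter.Eventually.of_forall fun t => sq_nonneg _)
          ((integrable_finsetSum _ hsqi).const_mul _) (Filter.Eventually.of_forall fun t => ?_)
        -- Cauchy–Schwarz for the telescoping sum `a N - a 0`
        have e : (a 0 t - a N t) ^ 2 = (∑ i ∈ Finset.range N, (a (i + 1) t - a i t)) ^ 2 := by
          rw [Finset.sum_range_sub (fun i => a i t)]; ring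
        simp only
        rw [e]
        refine sq_sum_le_card_mul_sum_sq.trans (le_of_eq ?_)
        rw [Finset.card_range]
    _ = N * ∑ i ∈ Finset.range N, ∫ t, (a (i + 1) t - a i t) ^ 2 ∂μ := by
        rw [integral_const_mul, integral_finsetSum _ hsqi]
    _ ≤ N * ∑ i ∈ Finset.range N, r := by
        gcongr with i hi; exact hstep i hi
    _ = N ^ 2 * r := by rw [Finset.sum_const, Finset.card_range, nsmul_eq_mul]; ring

end Hellinger

/-! ### Test functions under a differentially private channel -/

section DP

variable {𝒯 : Type*} [MeasurableSpace 𝒯] {n : ℕ}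

lemma integrable_of_measurable_of_abs_le {μ : Measure 𝒯} [IsFiniteMeasure μ] {φ : 𝒯 → ℝ} {M : ℝ}
    (hφ : Measurable φ) (hM : ∀ t, |φ t| ≤ M) : Integrable φ μ :=
  Integrable.of_bound hφ.aestronglyMeasurable M (Filter.Eventually.of_forall hM)

/-- The privacy constraint extends from events to bounded test functions by the layer cake
formula. -/
lemma IsDP.integral_le {ε δ : ℝ} (hδ : 0 ≤ δ) {K : Kernel (Fin n → Obs) 𝒯} [IsMarkovKernel K]
    (hK : IsDP ε δ K) {z z' : Fin n → Obs} (hz : hammingDist z z' ≤ 1) {φ : 𝒯 → ℝ} {M : ℝ}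
    (hφ : Measurable φ) (h0 : ∀ t, 0 ≤ φ t) (hM : ∀ t, φ t ≤ M) (hM0 : 0 ≤ M) :
    ∫ t, φ t ∂(K z) ≤ Real.exp ε * ∫ t, φ t ∂(K z') + δ * M := by
  have hi : ∀ w, Integrable φ (K w) := fun w => integrable_of_measurable_of_abs_le hφ
    (fun t => (abs_of_nonneg (h0 t)).trans_le (hM t))
  have hlc : ∀ w, ∫ t, φ t ∂(K w) = ∫ x in Set.Ioc 0 M, (K w).real {t | x ≤ φ t} := fun w =>
    (hi w).integral_eq_integral_Ioc_meas_le (Filter.Eventually.of_forall h0)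
      (Filter.Eventually.of_forall hM)
  have hanti : ∀ w, IntegrableOn (fun x => (K w).real {t | x ≤ φ t}) (Set.Ioc 0 M) := fun w => by
    refine AntitoneOn.integrableOn_isCompact (isCompact_Icc) ?_ |>.mono_set Set.Ioc_subset_Icc_self
    intro x _ y _ hxy
    exact measureReal_mono (fun t ht => hxy.trans ht)
  have hpt : ∀ x, (K z).real {t | x ≤ φ t} ≤ Real.exp ε * (K z').real {t | x ≤ φ t} + δ := by
    intro x
    have h1 := hK z z' hz {t | x ≤ φ t} (measurableSet_le measurable_const hφ)
    have h2 := ENNReal.toReal_mono (by finiteness) h1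
    rwa [ENNReal.toReal_add (by finiteness) (by finiteness), ENNReal.toReal_mul,
      ENNReal.toReal_ofReal (Real.exp_pos _).le, ENNReal.toReal_ofReal hδ] at h2
  rw [hlc, hlc]
  calc ∫ x in Set.Ioc 0 M, (K z).real {t | x ≤ φ t}
      ≤ ∫ x in Set.Ioc 0 M, (Real.exp ε * (K z').real {t | x ≤ φ t} + δ) :=
        integral_mono (hanti z) (((hanti z').const_mul _).add (by simp)) hpt
    _ = _ := by
        rw [integral_add ((hanti z').const_mul _) (by simp), integral_const_mul]
        simp [hM0, mul_comm]

/-- For a bounded test function of either sign, the change of the expectation is controlled by the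
first absolute moment under the neighbouring data set only. -/
lemma IsDP.abs_integral_sub_le {ε δ : ℝ} (hε : 0 ≤ ε) (hδ : 0 ≤ δ) {K : Kernel (Fin n → Obs) 𝒯}
    [IsMarkovKernel K] (hK : IsDP ε δ K) {z z' : Fin n → Obs} (hz : hammingDist z z' ≤ 1)
    {φ : 𝒯 → ℝ} {M : ℝ} (hφ : Measurable φ) (hM : ∀ t, |φ t| ≤ M) (hM0 : 0 ≤ M) :
    |∫ t, φ t ∂(K z) - ∫ t, φ t ∂(K z')| ≤
      (Real.exp ε - 1) * ∫ t, |φ t| ∂(K z') + 2 * δ * M := by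
  have hz' : hammingDist z' z ≤ 1 := by rwa [hammingDist_comm]
  have hp0 : ∀ t, 0 ≤ max (φ t) 0 := fun t => le_max_right _ _
  have hn0 : ∀ t, 0 ≤ max (-φ t) 0 := fun t => le_max_right _ _
  have hpM : ∀ t, max (φ t) 0 ≤ M := fun t => max_le ((le_abs_self _).trans (hM t)) hM0
  have hnM : ∀ t, max (-φ t) 0 ≤ M := fun t => max_le ((neg_le_abs _).trans (hM t)) hM0
  have hpm : Measurable fun t => max (φ t) 0 := hφ.max measurable_const
  have hnm : Measurable fun t => max (-φ t) 0 := hφ.neg.max measurable_const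
  have hi : ∀ w, Integrable φ (K w) := fun w => integrable_of_measurable_of_abs_le hφ hM
  have hpi : ∀ w, Integrable (fun t => max (φ t) 0) (K w) := fun w => (hi w).pos_part
  have hni : ∀ w, Integrable (fun t => max (-φ t) 0) (K w) := fun w => (hi w).neg_part
  have hdec : ∀ w, ∫ t, φ t ∂(K w) = ∫ t, max (φ t) 0 ∂(K w) - ∫ t, max (-φ t) 0 ∂(K w) := by
    intro w
    rw [← integral_sub (hpi w) (hni w)]
    refine integral_congr_ae (Filter.Eventually.of_forall fun t => ?_)
    rcases le_total 0 (φ t) with h | h <;> simp [h]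
  have habs : ∀ w, ∫ t, |φ t| ∂(K w) = ∫ t, max (φ t) 0 ∂(K w) + ∫ t, max (-φ t) 0 ∂(K w) := by
    intro w
    rw [← integral_add (hpi w) (hni w)]
    refine integral_congr_ae (Filter.Eventually.of_forall fun t => ?_)
    rcases le_total 0 (φ t) with h | h <;> simp [h, abs_of_nonneg, abs_of_nonpos]
  rw [hdec, hdec, habs]
  have p1 := hK.integral_le hδ hz hpm hp0 hpM hM0
  have p2 := hK.integral_le hδ hz' hpm hp0 hpM hM0
  have n1 := hK.integral_le hδ hz hnm hn0 hnM hM0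
  have n2 := hK.integral_le hδ hz' hnm hn0 hnM hM0
  have a1 : 0 ≤ ∫ t, max (φ t) 0 ∂(K z) := integral_nonneg hp0
  have a2 : 0 ≤ ∫ t, max (φ t) 0 ∂(K z') := integral_nonneg hp0
  have a3 : 0 ≤ ∫ t, max (-φ t) 0 ∂(K z) := integral_nonneg hn0
  have a4 : 0 ≤ ∫ t, max (-φ t) 0 ∂(K z') := integral_nonneg hn0
  have hδM : 0 ≤ δ * M := mul_nonneg hδ hM0
  generalize ∫ t, max (φ t) 0 ∂(K z) = A at *
  generalize ∫ t, max (φ t) 0 ∂(K z') = A' at *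
  generalize ∫ t, max (-φ t) 0 ∂(K z) = B at *
  generalize ∫ t, max (-φ t) 0 ∂(K z') = B' at *
  have he : 1 ≤ Real.exp ε := Real.one_le_exp hε
  -- dividing `x' ≤ e^ε x + δM` by `e^ε` turns it into a bound for `x' - x`
  have hdiv : ∀ x x' : ℝ, 0 ≤ x' → x' ≤ Real.exp ε * x + δ * M →
      x' - x ≤ (Real.exp ε - 1) * x' + δ * M := by
    intro x x' hx' h
    have h3 : Real.exp ε * (x' - x) ≤ Real.exp ε * ((Real.exp ε - 1) * x' + δ * M) := by
      nlinarith [mul_nonneg (sub_nonneg.2 he) hx', mul_nonneg (sub_nonneg.2 he) hδM,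
        mul_nonneg (sub_nonneg.2 he) (mul_nonneg (sub_nonneg.2 he) hx')]
    exact le_of_mul_le_mul_left h3 (Real.exp_pos _)
  have q1 := hdiv A A' a2 p2
  have q2 := hdiv B B' a4 n2
  rw [abs_le]
  constructor <;> nlinarith

/-! ### Resampling one coordinate -/

/-- Resampling one coordinate of an i.i.d. family does not change its law. -/
lemma measurePreserving_update {E ι : Type*} [Fintype ι] [DecidableEq ι] [MeasurableSpace E]
    (ρ : Measure E) [IsProbabilityMeasure ρ] (i : ι) :
    MeasurePreserving (fun p : (ι → E) × E => Function.update p.1 i p.2)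
      ((Measure.pi fun _ => ρ).prod ρ) (Measure.pi fun _ => ρ) := by
  have hm : Measurable (fun p : (ι → E) × E => Function.update p.1 i p.2) :=
    measurable_update'
  refine ⟨hm, ?_⟩
  symm
  refine (Measure.pi_eq fun s hs => ?_)
  rw [Measure.map_apply hm (MeasurableSet.univ_pi hs)]
  have hpre : (fun p : (ι → E) × E => Function.update p.1 i p.2) ⁻¹' (Set.pi Set.univ s) =
      (Set.pi Set.univ (Function.update s i Set.univ)) ×ˢ s i := by
    ext p
    simp only [Set.mem_preimage, Set.mem_pi, Set.mem_univ, true_imp_iff, Set.mem_prod]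
    constructor
    · intro h
      refine ⟨fun j => ?_, by simpa using h i⟩
      rcases eq_or_ne j i with rfl | hj
      · simp
      · simpa [hj] using h j
    · rintro ⟨h1, h2⟩ j
      rcases eq_or_ne j i with rfl | hj
      · simpa using h2
      · simpa [hj] using h1 j
  rw [hpre, Measure.prod_prod, Measure.pi_pi, mul_comm]
  rw [← Finset.mul_prod_erase _ _ (Finset.mem_univ i),
    ← Finset.mul_prod_erase _ (fun j => ρ (s j)) (Finset.mem_univ i)]
  simp only [Function.update_self, measure_univ, one_mul]
  congr 1
  refine Finset.prod_congr rfl fun j hj => ?_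
  rw [Function.update_of_ne (Finset.ne_of_mem_erase hj)]

lemma hammingDist_update_le_one {E : Type*} [DecidableEq E] (z : Fin n → E) (i : Fin n) (x : E) :
    hammingDist (Function.update z i x) z ≤ 1 := by
  unfold hammingDist
  refine (Finset.card_le_card (t := {i}) fun j hj => ?_).trans (by simp)
  by_contra hne
  simp only [Finset.mem_singleton] at hne
  simp [Function.update_of_ne hne] at hj

section Joint

variable (ρ : Measure Obs) [IsProbabilityMeasure ρ] (K : Kernel (Fin n → Obs) 𝒯) [IsMarkovKernel K]

/-- The joint law of a sample of `n` i.i.d. observations from `ρ` and of its transcript. -/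
def jointLaw : Measure ((Fin n → Obs) × 𝒯) := (Measure.pi fun _ => ρ) ⊗ₘ K

instance : IsProbabilityMeasure (jointLaw ρ K) := by unfold jointLaw; infer_instance

variable {ρ K}

lemma integrable_jointLaw_fst {F : (Fin n → Obs) → ℝ}
    (hF : Integrable F (Measure.pi fun _ => ρ)) :
    Integrable (fun p => F p.1) (jointLaw ρ K) := by
  have : (jointLaw ρ K).map Prod.fst = Measure.pi fun _ => ρ := Measure.fst_compProd _ _
  exact (this ▸ hF : Integrable F ((jointLaw ρ K).map Prod.fst)).comp_measurable measurable_fst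

lemma integral_jointLaw_fst {F : (Fin n → Obs) → ℝ}
    (hF : Integrable F (Measure.pi fun _ => ρ)) :
    ∫ p, F p.1 ∂(jointLaw ρ K) = ∫ z, F z ∂(Measure.pi fun _ => ρ) := by
  have h : (jointLaw ρ K).map Prod.fst = Measure.pi fun _ => ρ := Measure.fst_compProd _ _
  rw [← h, integral_map measurable_fst.aemeasurable (h ▸ hF.aestronglyMeasurable)]

lemma integrable_jointLaw_mul {F : (Fin n → Obs) → ℝ} {φ : 𝒯 → ℝ} {M : ℝ}
    (hF : Integrable F (Measure.pi fun _ => ρ)) (hφ : Measurable φ) (hM : ∀ t, |φ t| ≤ M) :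
    Integrable (fun p => F p.1 * φ p.2) (jointLaw ρ K) :=
  (integrable_jointLaw_fst hF).mul_bdd (c := M) (hφ.comp measurable_snd).aestronglyMeasurable
    (Filter.Eventually.of_forall fun p => hM p.2)

lemma integral_jointLaw_mul {F : (Fin n → Obs) → ℝ} {φ : 𝒯 → ℝ} {M : ℝ}
    (hF : Integrable F (Measure.pi fun _ => ρ)) (hφ : Measurable φ) (hM : ∀ t, |φ t| ≤ M) :
    ∫ p, F p.1 * φ p.2 ∂(jointLaw ρ K) =
      ∫ z, F z * ∫ t, φ t ∂(K z) ∂(Measure.pi fun _ => ρ) := by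
  rw [jointLaw, Measure.integral_compProd (integrable_jointLaw_mul hF hφ hM)]
  simp_rw [integral_const_mul]

lemma integral_jointLaw_snd {φ : 𝒯 → ℝ} (hφ : Measurable φ) :
    ∫ p, φ p.2 ∂(jointLaw ρ K) = ∫ t, φ t ∂((Measure.pi fun _ => ρ).bind K) := by
  have h : (jointLaw ρ K).map Prod.snd = (Measure.pi fun _ => ρ).bind K := Measure.snd_compProd _ _
  rw [← h, integral_map measurable_snd.aemeasurable hφ.aestronglyMeasurable]

/-- Under an `(ε, δ)`-differentially private channel, a bounded function of the transcript is nearly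
uncorrelated with a centred function `ℓ - 1` of one observation. -/
lemma IsDP.abs_integral_weight_mul_le {ε δ : ℝ} (hε : 0 ≤ ε) (hδ : 0 ≤ δ) (hK : IsDP ε δ K)
    (i : Fin n) {W : (Fin n → Obs) → ℝ} (hWm : Measurable W) (hW0 : ∀ z, 0 ≤ W z)
    (hWi : Integrable W (Measure.pi fun _ => ρ)) (hW1 : ∫ z, W z ∂(Measure.pi fun _ => ρ) = 1)
    (hWu : ∀ z x, W (Function.update z i x) = W z) {l : Obs → ℝ} (hlm : Measurable l)
    (hl : Integrable l ρ) (hl1 : ∫ x, l x ∂ρ = 1) {φ : 𝒯 → ℝ} {M : ℝ}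
    (hφ : Measurable φ) (hM : ∀ t, |φ t| ≤ M) (hM0 : 0 ≤ M) :
    Integrable (fun z => W z * (l (z i) - 1)) (Measure.pi fun _ => ρ) ∧
    |∫ p, (W p.1 * (l (p.1 i) - 1)) * φ p.2 ∂(jointLaw ρ K)| ≤
      (∫ x, |l x - 1| ∂ρ) *
        ((Real.exp ε - 1) * ∫ p, W p.1 * |φ p.2| ∂(jointLaw ρ K) + 2 * δ * M) := by
  classical
  have hmp := measurePreserving_update ρ i
  have hl' : Integrable (fun x => l x - 1) ρ := hl.sub (integrable_const 1)
  have hGm : Measurable (fun z : Fin n → Obs => W z * (l (z i) - 1)) := by fun_prop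
  have hG : Integrable (fun z => W z * (l (z i) - 1)) (Measure.pi fun _ => ρ) := by
    rw [← hmp.integrable_comp hGm.aestronglyMeasurable]
    refine (hWi.mul_prod hl').congr (Filter.Eventually.of_forall fun p => ?_)
    simp [hWu]
  refine ⟨hG, ?_⟩
  have hΦm : Measurable fun z => ∫ t, φ t ∂(K z) :=
    (hφ.stronglyMeasurable.integral_kernel (κ := K)).measurable
  have hΦb : ∀ z, |∫ t, φ t ∂(K z)| ≤ M := fun z => by
    have := norm_integral_le_of_norm_le_const (μ := K z) (f := φ) (C := M)
      (Filter.Eventually.of_forall hM)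
    simpa using this
  have habsM : ∀ t, |(|φ t|)| ≤ M := fun t => by rw [abs_abs]; exact hM t
  have hAm : Measurable fun z => ∫ t, |φ t| ∂(K z) :=
    (hφ.abs.stronglyMeasurable.integral_kernel (κ := K)).measurable
  rw [integral_jointLaw_mul hG hφ hM, integral_jointLaw_mul hWi hφ.abs habsM]
  set Φ : (Fin n → Obs) → ℝ := fun z => ∫ t, φ t ∂(K z) with hΦ
  set A : (Fin n → Obs) → ℝ := fun z => ∫ t, |φ t| ∂(K z) with hA
  have hGΦ : Integrable (fun z => W z * (l (z i) - 1) * Φ z) (Measure.pi fun _ => ρ) :=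
    hG.mul_bdd (c := M) hΦm.aestronglyMeasurable (Filter.Eventually.of_forall hΦb)
  have hAb : ∀ z, ‖A z‖ ≤ M := fun z => by
    have := norm_integral_le_of_norm_le_const (μ := K z) (f := fun t => |φ t|) (C := M)
      (Filter.Eventually.of_forall habsM)
    simpa using this
  have hWA : Integrable (fun z => W z * A z) (Measure.pi fun _ => ρ) :=
    hWi.mul_bdd (c := M) hAm.aestronglyMeasurable (Filter.Eventually.of_forall hAb)
  have hGΦ' := (hmp.integrable_comp hGΦ.aestronglyMeasurable).2 hGΦ
  have hinner : ∀ z, |∫ x, (l x - 1) * Φ (Function.update z i x) ∂ρ| ≤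
      (∫ x, |l x - 1| ∂ρ) * ((Real.exp ε - 1) * A z + 2 * δ * M) := by
    intro z
    have hi1 : Integrable (fun x => (l x - 1) * Φ (Function.update z i x)) ρ :=
      hl'.mul_bdd (c := M) (hΦm.comp (measurable_update z)).aestronglyMeasurable
        (Filter.Eventually.of_forall fun x => hΦb _)
    -- as `l - 1` is centred, the value of `Φ` at `z`, which does not depend on the resampled
    -- observation, may be subtracted
    have hcen : ∫ x, (l x - 1) * Φ (Function.update z i x) ∂ρ =
        ∫ x, (l x - 1) * (Φ (Function.update z i x) - Φ z) ∂ρ := by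
      simp_rw [mul_sub]
      rw [integral_sub hi1 (hl'.mul_const _), integral_mul_const,
        integral_sub hl (integrable_const 1), hl1]
      simp
    rw [hcen, ← integral_mul_const]
    refine (abs_integral_le_integral_abs).trans ?_
    refine integral_mono_of_nonneg (Filter.Eventually.of_forall fun x => abs_nonneg _)
      (hl'.abs.mul_const _) (Filter.Eventually.of_forall fun x => ?_)
    simp only [abs_mul]
    gcongr
    exact hK.abs_integral_sub_le hε hδ (hammingDist_update_le_one z i x) hφ hM hM0
  calc |∫ z, W z * (l (z i) - 1) * Φ z ∂(Measure.pi fun _ => ρ)|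
      = |∫ z, W z * ∫ x, (l x - 1) * Φ (Function.update z i x) ∂ρ ∂(Measure.pi fun _ => ρ)| := by
        have e := integral_map (f := fun z => W z * (l (z i) - 1) * Φ z) hmp.aemeasurable
          (by rw [hmp.map_eq]; exact hGΦ.aestronglyMeasurable)
        rw [hmp.map_eq] at e
        rw [e]
        refine congrArg _ ((integral_prod _ hGΦ').trans ?_)
        simp only [Function.comp_apply]
        simp only [hWu, Function.update_self, mul_assoc, integral_const_mul]
    _ ≤ ∫ z, W z * ((∫ x, |l x - 1| ∂ρ) * ((Real.exp ε - 1) * A z + 2 * δ * M))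
          ∂(Measure.pi fun _ => ρ) := by
        refine (abs_integral_le_integral_abs).trans ?_
        refine integral_mono_of_nonneg (Filter.Eventually.of_forall fun x => abs_nonneg _) ?_
          (Filter.Eventually.of_forall fun z => ?_)
        · refine ((hWA.const_mul ((∫ x, |l x - 1| ∂ρ) * (Real.exp ε - 1))).add
            (hWi.const_mul ((∫ x, |l x - 1| ∂ρ) * (2 * δ * M)))).congr
            (Filter.Eventually.of_forall fun z => ?_)
          simp only [Pi.add_apply]; ring
        · simp only [abs_mul, abs_of_nonneg (hW0 z)]
          gcongr
          · exact hW0 z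
          · exact hinner z
    _ = _ := by
        have : ∀ z, W z * ((∫ x, |l x - 1| ∂ρ) * ((Real.exp ε - 1) * A z + 2 * δ * M)) =
            ((∫ x, |l x - 1| ∂ρ) * (Real.exp ε - 1)) * (W z * A z) +
              ((∫ x, |l x - 1| ∂ρ) * (2 * δ * M)) * W z := fun z => by ring
        simp_rw [this]
        rw [integral_add (hWA.const_mul _) (hWi.const_mul _), integral_const_mul,
          integral_const_mul, hW1]
        ring

end Joint

end DP

/-! ### One step: discrimination of the transcript laws of two nearby data laws -/

section Step

variable {𝒯 : Type*} [MeasurableSpace 𝒯] {n : ℕ} {ρ : Measure Obs} [IsProbabilityMeasure ρ]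
  {K : Kernel (Fin n → Obs) 𝒯} [IsMarkovKernel K] {l : Obs → ℝ}

/-- The likelihood ratio of the sample when one observation has likelihood ratio `l`. -/
def sampleRatio (n : ℕ) (l : Obs → ℝ) (z : Fin n → Obs) : ℝ := ∏ i, l (z i)

lemma integrable_sampleRatio (hl : Integrable l ρ) :
    Integrable (sampleRatio n l) (Measure.pi fun _ => ρ) := Integrable.fintype_prod (fun _ => hl)

lemma integral_bind_withDensity (hl : Measurable l) (hl0 : ∀ x, 0 ≤ l x) (hli : Integrable l ρ)
    {φ : 𝒯 → ℝ} {M : ℝ} (hφ : Measurable φ) (hM : ∀ t, |φ t| ≤ M) :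
    ∫ t, φ t ∂((Measure.pi fun _ : Fin n => ρ.withDensity fun x => ENNReal.ofReal (l x)).bind K) =
      ∫ p, sampleRatio n l p.1 * φ p.2 ∂(jointLaw ρ K) := by
  have hfin : IsFiniteMeasure (ρ.withDensity fun x => ENNReal.ofReal (l x)) :=
    isFiniteMeasure_withDensity_ofReal hli.2
  have h : ((Measure.pi fun _ : Fin n => ρ.withDensity fun x => ENNReal.ofReal (l x)) ⊗ₘ K).map
      Prod.snd = (Measure.pi fun _ : Fin n => ρ.withDensity fun x => ENNReal.ofReal (l x)).bind K :=
    Measure.snd_compProd _ _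
  have hint : Integrable (fun p : (Fin n → Obs) × 𝒯 => φ p.2)
      ((Measure.pi fun _ : Fin n => ρ.withDensity fun x => ENNReal.ofReal (l x)) ⊗ₘ K) :=
    Integrable.of_bound (hφ.comp measurable_snd).aestronglyMeasurable M
      (Filter.Eventually.of_forall fun p => hM p.2)
  rw [← h, integral_map measurable_snd.aemeasurable hφ.aestronglyMeasurable,
    Measure.integral_compProd hint, integral_jointLaw_mul (integrable_sampleRatio hli) hφ hM,
    pi_withDensity_ofReal (fun _ : Fin n => ρ) (fun _ => l) (fun _ => hl0) (fun _ => hli),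
    integral_withDensity_ofReal (p := fun z : Fin n → Obs => ∏ i, l (z i)) (by fun_prop)
      (fun z => Finset.prod_nonneg fun i _ => hl0 _)]
  rfl

lemma integral_bind_withDensity_sub (hl : Measurable l) (hl0 : ∀ x, 0 ≤ l x)
    (hli : Integrable l ρ) {φ : 𝒯 → ℝ} {M : ℝ} (hφ : Measurable φ) (hM : ∀ t, |φ t| ≤ M) :
    ∫ t, φ t ∂((Measure.pi fun _ : Fin n => ρ.withDensity fun x => ENNReal.ofReal (l x)).bind K) -
        ∫ t, φ t ∂((Measure.pi fun _ : Fin n => ρ).bind K) =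
      ∫ p, (sampleRatio n l p.1 - 1) * φ p.2 ∂(jointLaw ρ K) := by
  have hint : Integrable (fun p : (Fin n → Obs) × 𝒯 => φ p.2) (jointLaw ρ K) :=
    integrable_of_measurable_of_abs_le (hφ.comp measurable_snd) fun p => hM p.2
  rw [integral_bind_withDensity hl hl0 hli hφ hM, ← integral_jointLaw_snd hφ, ← integral_sub
    (integrable_jointLaw_mul (integrable_sampleRatio hli) hφ hM) hint]
  simp only [sub_mul, one_mul]

/-- Data processing: the transcript is no more informative than the sample. -/
lemma discriminationLE_of_integral_sq (hl : Measurable l) (hl0 : ∀ x, 0 ≤ l x)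
    (hli : Integrable l ρ)
    (h2 : Integrable (fun z => (sampleRatio n l z - 1) ^ 2) (Measure.pi fun _ => ρ)) :
    DiscriminationLE ((Measure.pi fun _ : Fin n => ρ).bind K)
      ((Measure.pi fun _ : Fin n => ρ.withDensity fun x => ENNReal.ofReal (l x)).bind K)
      (∫ z, (sampleRatio n l z - 1) ^ 2 ∂(Measure.pi fun _ => ρ)) := by
  intro φ hφ hφ1 hs
  have h0 := hs 0
  simp only [mul_zero, zero_add, pow_one] at h0
  have hL : Integrable (fun z => sampleRatio n l z - 1) (Measure.pi fun _ => ρ) :=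
    (integrable_sampleRatio hli).sub (integrable_const 1)
  have hφ2 : Integrable (fun p : (Fin n → Obs) × 𝒯 => φ p.2 ^ 2) (jointLaw ρ K) :=
    integrable_of_measurable_of_abs_le (M := 1) (by fun_prop) fun p => by
      rw [abs_pow]; exact pow_le_one₀ (abs_nonneg _) (hφ1 _)
  rw [integral_bind_withDensity_sub hl hl0 hli hφ hφ1] at h0 ⊢
  rw [← integral_jointLaw_snd (hφ.pow_const 2)] at h0
  rw [← integral_jointLaw_fst (K := K) h2]
  have h2' := integrable_jointLaw_fst (K := K) h2
  have := integral_mono (integrable_jointLaw_mul (K := K) hL hφ hφ1)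
    ((h2'.const_mul (1 / 2)).add (hφ2.const_mul (1 / 2))) (fun p => by
      simp only [Pi.add_apply]
      nlinarith [sq_nonneg ((sampleRatio n l p.1 - 1) - φ p.2)])
  rw [integral_add' (h2'.const_mul (1 / 2)) (hφ2.const_mul (1 / 2)), integral_const_mul,
    integral_const_mul] at this
  linarith

lemma mul_pow_le_pow_add_pow {a b : ℝ} (ha : 0 ≤ a) (hb : 0 ≤ b) (k : ℕ) :
    a * b ^ k ≤ a ^ (k + 1) + b ^ (k + 1) := by
  rcases le_total a b with h | h
  · have : a * b ^ k ≤ b ^ (k + 1) := by rw [pow_succ']; gcongr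
    have := pow_nonneg ha (k + 1)
    linarith
  · have : a * b ^ k ≤ a ^ (k + 1) := by rw [pow_succ']; gcongr
    have := pow_nonneg hb (k + 1)
    linarith

/-- The weight `∏_{j < i} l (z_j)` of the telescoping decomposition of `∏ l - 1`. -/
def partialRatio (l : Obs → ℝ) (i : Fin n) (z : Fin n → Obs) : ℝ :=
  ∏ j, if j < i then l (z j) else 1

/-- The telescoping decomposition of `∏ l - 1`. -/
lemma sampleRatio_sub_one_eq_sum (l : Obs → ℝ) (z : Fin n → Obs) :
    sampleRatio n l z - 1 = ∑ i, partialRatio l i z * (l (z i) - 1) := by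
  have h := Finset.prod_add_ordered (Finset.univ : Finset (Fin n)) (fun _ => (1 : ℝ))
    (fun i => l (z i) - 1)
  simp only [add_sub_cancel, Finset.prod_const_one, mul_one] at h
  rw [sampleRatio, h, add_sub_cancel_left]
  refine Finset.sum_congr rfl fun i _ => ?_
  rw [partialRatio, Finset.prod_filter, mul_comm]

lemma integral_partialRatio_pow (i : Fin n) {k : ℕ} (hk : Integrable (fun x => l x ^ k) ρ) :
    Integrable (fun z => partialRatio l i z ^ k) (Measure.pi fun _ => ρ) ∧
    ∫ z, partialRatio l i z ^ k ∂(Measure.pi fun _ => ρ) =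
      ∏ j : Fin n, if j < i then ∫ x, l x ^ k ∂ρ else 1 := by
  have e : ∀ z : Fin n → Obs, partialRatio l i z ^ k =
      ∏ j, (fun (j : Fin n) (x : Obs) => if j < i then l x ^ k else 1) j (z j) := by
    intro z
    rw [partialRatio, ← Finset.prod_pow]
    refine Finset.prod_congr rfl fun j _ => ?_
    by_cases h : j < i <;> simp [h]
  simp_rw [e]
  constructor
  · refine Integrable.fintype_prod_dep (μ := fun _ => ρ)
      (f := fun (j : Fin n) (x : Obs) => if j < i then l x ^ k else 1) fun j => ?_
    by_cases h : j < i
    · simpa [h] using hk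
    · simp [h]
  · rw [integral_fintype_prod_eq_prod (μ := fun _ : Fin n => ρ)
      (fun (j : Fin n) (x : Obs) => if j < i then l x ^ k else 1)]
    refine Finset.prod_congr rfl fun j _ => ?_
    by_cases h : j < i <;> simp [h]

/-- The discrimination of the transcript laws under an `(ε, δ)`-differentially private channel. The
`β²` is the contribution of pure privacy; the test function is truncated at the level `M`, which
costs `δ M` below and a moment of order `2 s + 2` above this level. -/
lemma discriminationLE_of_isDP {ε δ : ℝ} (hε : 0 ≤ ε) (hδ : 0 ≤ δ) (hK : IsDP ε δ K)
    (hl : Measurable l) (hl0 : ∀ x, 0 ≤ l x) (hl1 : ∫ x, l x ∂ρ = 1)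
    (hl2 : Integrable (fun x => l x ^ 2) ρ) (hl4 : (∫ x, l x ^ 2 ∂ρ) ^ n ≤ 4) {e₁ : ℝ}
    (he₁ : ∫ x, |l x - 1| ∂ρ ≤ e₁) {s : ℕ} {V : ℝ}
    (hsi : Integrable (fun z => (sampleRatio n l z - 1) ^ (2 * s + 2)) (Measure.pi fun _ => ρ))
    (hV : ∫ z, (sampleRatio n l z - 1) ^ (2 * s + 2) ∂(Measure.pi fun _ => ρ) ≤ V) {M : ℝ}
    (hM : 0 < M) :
    DiscriminationLE ((Measure.pi fun _ : Fin n => ρ).bind K)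
      ((Measure.pi fun _ : Fin n => ρ.withDensity fun x => ENNReal.ofReal (l x)).bind K)
      (8 * (n * e₁ * (Real.exp ε - 1)) ^ 2 + 4 * (n * e₁ * δ * M) +
        2 ^ (2 * s + 4) * V / M ^ (2 * s)) := by
  intro φ hφ hφ1 hs
  have he0 : 0 ≤ ∫ x, |l x - 1| ∂ρ := integral_nonneg fun _ => abs_nonneg _
  have hε1 : 0 ≤ Real.exp ε - 1 := sub_nonneg.2 (Real.one_le_exp hε)
  have hli : Integrable l ρ := by
    refine (hl2.add (integrable_const (1 : ℝ))).mono' hl.aestronglyMeasurable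
      (Filter.Eventually.of_forall fun x => ?_)
    rw [Real.norm_eq_abs, abs_of_nonneg (hl0 x)]
    simp only [Pi.add_apply]
    nlinarith [sq_nonneg (l x - 1)]
  have hL : Integrable (fun z => sampleRatio n l z - 1) (Measure.pi fun _ => ρ) :=
    (integrable_sampleRatio hli).sub (integrable_const 1)
  have hpow : ∀ k : ℕ, ∀ t, |φ t ^ k| ≤ 1 := fun k t => by
    rw [abs_pow]; exact pow_le_one₀ (abs_nonneg _) (hφ1 _)
  have hφk : ∀ k : ℕ, Integrable (fun p : (Fin n → Obs) × 𝒯 => φ p.2 ^ k) (jointLaw ρ K) :=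
    fun k => integrable_of_measurable_of_abs_le (M := 1) (by fun_prop) fun p => hpow k _
  have hmom : ∀ k : ℕ, ∫ p, φ p.2 ^ (2 * k + 2) ∂(jointLaw ρ K) ≤
      ∫ p, (sampleRatio n l p.1 - 1) * φ p.2 ^ (2 * k + 1) ∂(jointLaw ρ K) := fun k => by
    have := hs k
    rwa [integral_bind_withDensity_sub hl hl0 hli (hφ.pow_const _) (hpow _),
      ← integral_jointLaw_snd (hφ.pow_const _)] at this
  rw [integral_bind_withDensity_sub hl hl0 hli hφ hφ1]
  set Δ := ∫ p, (sampleRatio n l p.1 - 1) * φ p.2 ∂(jointLaw ρ K) with hΔ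
  have hφΔ : ∫ p, φ p.2 ^ 2 ∂(jointLaw ρ K) ≤ Δ := by simpa using hmom 0
  have hsi' := integrable_jointLaw_fst (K := K) hsi
  have hV' : ∫ p, (sampleRatio n l p.1 - 1) ^ (2 * s + 2) ∂(jointLaw ρ K) ≤ V := by
    rw [integral_jointLaw_fst (K := K) hsi]; exact hV
  have hV0 : 0 ≤ V := (integral_nonneg fun z => Even.pow_nonneg ⟨s + 1, by ring⟩ _).trans hV
  -- the moment of the test function, by Young's inequality
  have hX : ∫ p, φ p.2 ^ (2 * s + 2) ∂(jointLaw ρ K) ≤ 2 ^ (2 * s + 2) * V := by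
    have hpt : ∀ p : (Fin n → Obs) × 𝒯, (sampleRatio n l p.1 - 1) * φ p.2 ^ (2 * s + 1) ≤
        2 ^ (2 * s + 1) * (sampleRatio n l p.1 - 1) ^ (2 * s + 2) +
          1 / 2 * φ p.2 ^ (2 * s + 2) := by
      intro p
      have hev : Even (2 * s + 2) := ⟨s + 1, by ring⟩
      have h1 := mul_pow_le_pow_add_pow (a := 2 * |sampleRatio n l p.1 - 1|) (b := |φ p.2|)
        (by positivity) (abs_nonneg _) (2 * s + 1)
      have h2 : (sampleRatio n l p.1 - 1) * φ p.2 ^ (2 * s + 1) ≤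
          |sampleRatio n l p.1 - 1| * |φ p.2| ^ (2 * s + 1) := by
        rw [← abs_pow, ← abs_mul]; exact le_abs_self _
      rw [mul_pow, show 2 * s + 1 + 1 = 2 * s + 2 by ring, hev.pow_abs, hev.pow_abs,
        show (2 : ℝ) ^ (2 * s + 2) = 2 * 2 ^ (2 * s + 1) by ring] at h1
      linarith
    have h1 := integral_mono
      (integrable_jointLaw_mul (K := K) hL (hφ.pow_const (2 * s + 1)) (hpow _))
      ((hsi'.const_mul (2 ^ (2 * s + 1))).add ((hφk (2 * s + 2)).const_mul (1 / 2))) hpt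
    rw [integral_add' (hsi'.const_mul _) ((hφk _).const_mul _), integral_const_mul,
      integral_const_mul] at h1
    have h2 := hmom s
    have h3 : (2 : ℝ) ^ (2 * s + 1) * ∫ p, (sampleRatio n l p.1 - 1) ^ (2 * s + 2) ∂(jointLaw ρ K)
        ≤ 2 ^ (2 * s + 1) * V := by gcongr
    have h4 : (2 : ℝ) ^ (2 * s + 2) = 2 * 2 ^ (2 * s + 1) := by ring
    rw [h4]
    linarith
  -- truncation of the test function
  set φM : 𝒯 → ℝ := fun t => if |φ t| ≤ M then φ t else 0 with hφM
  have hφMm : Measurable φM := Measurable.ite (measurableSet_le hφ.abs measurable_const) hφ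
    measurable_const
  have hφMM : ∀ t, |φM t| ≤ M := fun t => by
    simp only [hφM]; split_ifs with h
    · exact h
    · simpa using hM.le
  have hφMφ : ∀ t, |φM t| ≤ |φ t| := fun t => by
    simp only [hφM]; split_ifs with h <;> simp
  have hWi : ∀ i : Fin n, Integrable (partialRatio l i) (Measure.pi fun _ => ρ) := fun i => by
    simpa using (integral_partialRatio_pow i (k := 1) (by simpa using hli)).1
  have hW1 : ∀ i : Fin n, ∫ z, partialRatio l i z ∂(Measure.pi fun _ => ρ) = 1 := fun i => by
    have := (integral_partialRatio_pow i (k := 1) (by simpa using hli)).2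
    simpa [hl1] using this
  have hone : 1 ≤ ∫ x, l x ^ 2 ∂ρ := by
    have h1 := integral_mono (μ := ρ) ((hli.const_mul 2).sub (integrable_const (1 : ℝ))) hl2
      fun x => by simp only [Pi.sub_apply]; nlinarith [sq_nonneg (l x - 1)]
    rw [integral_sub' (hli.const_mul 2) (integrable_const _), integral_const_mul, hl1] at h1
    simp only [integral_const, probReal_univ, smul_eq_mul] at h1
    linarith
  have hW2 : ∀ i : Fin n, ∫ z, partialRatio l i z ^ 2 ∂(Measure.pi fun _ => ρ) ≤ 4 := fun i => by
    rw [(integral_partialRatio_pow i hl2).2]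
    refine le_trans ?_ hl4
    refine (Finset.prod_le_prod (g := fun _ => ∫ x, l x ^ 2 ∂ρ) (fun j _ => ?_)
      fun j _ => ?_).trans ?_
    · split_ifs <;> linarith
    · split_ifs <;> linarith
    · simp
  have hW0 : ∀ (i : Fin n) z, 0 ≤ partialRatio l i z := fun i z =>
    Finset.prod_nonneg fun j _ => by split_ifs; exacts [hl0 _, zero_le_one]
  have hterm : ∀ i : Fin n,
      Integrable (fun z => partialRatio l i z * (l (z i) - 1)) (Measure.pi fun _ => ρ) ∧
      |∫ p, (partialRatio l i p.1 * (l (p.1 i) - 1)) * φM p.2 ∂(jointLaw ρ K)| ≤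
      (∫ x, |l x - 1| ∂ρ) * ((Real.exp ε - 1) *
        ∫ p, partialRatio l i p.1 * |φM p.2| ∂(jointLaw ρ K) + 2 * δ * M) := fun i =>
    hK.abs_integral_weight_mul_le hε hδ i
      (Finset.measurable_prod _ fun j _ => by split_ifs <;> fun_prop) (hW0 i)
      (hWi i) (hW1 i) (fun z x => Finset.prod_congr rfl fun j _ => by
        split_ifs with h
        · rw [Function.update_of_ne h.ne]
        · rfl) hl hli hl1 hφMm hφMM hM.le
  set β := n * e₁ * (Real.exp ε - 1) with hβ
  have hβ0 : 0 ≤ β := mul_nonneg (mul_nonneg n.cast_nonneg (he0.trans he₁)) hε1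
  have hbody : ∫ p, (sampleRatio n l p.1 - 1) * φM p.2 ∂(jointLaw ρ K) ≤
      4 * β ^ 2 + Δ / 4 + 2 * (n * e₁ * δ * M) := by
    have hexp : ∀ p : (Fin n → Obs) × 𝒯, (sampleRatio n l p.1 - 1) * φM p.2 =
        ∑ i, (partialRatio l i p.1 * (l (p.1 i) - 1)) * φM p.2 := fun p => by
      rw [sampleRatio_sub_one_eq_sum, Finset.sum_mul]
    simp_rw [hexp]
    rw [integral_finsetSum _ fun i _ => integrable_jointLaw_mul (hterm i).1 hφMm hφMM]
    rcases Nat.eq_zero_or_pos n with hn | hn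
    · subst hn
      have hΔ0 : 0 ≤ Δ := (integral_nonneg fun p => sq_nonneg _).trans hφΔ
      simp only [Finset.univ_eq_empty, Finset.sum_empty, Nat.cast_zero, zero_mul, mul_zero]
      positivity
    have hn' : (0 : ℝ) < n := by exact_mod_cast hn
    have hi : ∀ i : Fin n,
        ∫ p, (partialRatio l i p.1 * (l (p.1 i) - 1)) * φM p.2 ∂(jointLaw ρ K) ≤
        (4 * β ^ 2 + Δ / 4 + 2 * (n * e₁ * δ * M)) / n := by
      intro i
      refine (le_abs_self _).trans ((hterm i).2.trans ?_)
      have hW2i := integrable_jointLaw_fst (K := K) (integral_partialRatio_pow i hl2).1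
      have hWφ : β * ∫ p, partialRatio l i p.1 * |φM p.2| ∂(jointLaw ρ K) ≤
          4 * β ^ 2 + Δ / 4 := by
        have h1 := integral_mono ((integrable_jointLaw_mul (K := K) (hWi i) hφMm.abs
          (M := M) (fun t => by rw [abs_abs]; exact hφMM t)).const_mul β)
          ((hW2i.const_mul (β ^ 2)).add ((hφk 2).const_mul (1 / 4))) fun p => by
            simp only [Pi.add_apply]
            have h2 : partialRatio l i p.1 * |φM p.2| ≤ partialRatio l i p.1 * |φ p.2| :=
              mul_le_mul_of_nonneg_left (hφMφ _) (hW0 i _)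
            have h3 := mul_le_mul_of_nonneg_left h2 hβ0
            nlinarith [sq_nonneg (β * partialRatio l i p.1 - |φ p.2| / 2), sq_abs (φ p.2)]
        rw [integral_add' (hW2i.const_mul _) ((hφk 2).const_mul _), integral_const_mul,
          integral_const_mul, integral_const_mul, integral_jointLaw_fst (K := K)
          (integral_partialRatio_pow i hl2).1] at h1
        nlinarith [hW2 i, sq_nonneg β]
      have hY : 0 ≤ ∫ p, partialRatio l i p.1 * |φM p.2| ∂(jointLaw ρ K) :=
        integral_nonneg fun p => mul_nonneg (hW0 i _) (abs_nonneg _)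
      generalize ∫ p, partialRatio l i p.1 * |φM p.2| ∂(jointLaw ρ K) = Y at hWφ hY ⊢
      rw [le_div_iff₀ hn']
      calc (∫ x, |l x - 1| ∂ρ) * ((Real.exp ε - 1) * Y + 2 * δ * M) * n
          ≤ e₁ * ((Real.exp ε - 1) * Y + 2 * δ * M) * n := by gcongr
        _ = β * Y + 2 * (n * e₁ * δ * M) := by rw [hβ]; ring
        _ ≤ _ := by linarith
    refine (Finset.sum_le_sum fun i _ => hi i).trans (le_of_eq ?_)
    rw [Finset.sum_const, Finset.card_univ, Fintype.card_fin, nsmul_eq_mul]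
    field_simp
  have htail : ∫ p, (sampleRatio n l p.1 - 1) * (φ p.2 - φM p.2) ∂(jointLaw ρ K) ≤
      2 ^ (2 * s + 3) * V / M ^ (2 * s) := by
    have hpt : ∀ p : (Fin n → Obs) × 𝒯, (sampleRatio n l p.1 - 1) * (φ p.2 - φM p.2) ≤
        (M ^ (2 * s))⁻¹ * ((sampleRatio n l p.1 - 1) ^ (2 * s + 2) + φ p.2 ^ (2 * s + 2)) := by
      intro p
      have hev : Even (2 * s + 2) := ⟨s + 1, by ring⟩
      have hnn : 0 ≤ (M ^ (2 * s))⁻¹ *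
          ((sampleRatio n l p.1 - 1) ^ (2 * s + 2) + φ p.2 ^ (2 * s + 2)) :=
        mul_nonneg (by positivity) (add_nonneg (hev.pow_nonneg _) (hev.pow_nonneg _))
      by_cases h : |φ p.2| ≤ M
      · have : φM p.2 = φ p.2 := by simp only [hφM, if_pos h]
        rw [this, sub_self, mul_zero]; exact hnn
      · have h0 : φM p.2 = 0 := by simp only [hφM, if_neg h]
        rw [h0, sub_zero, inv_mul_eq_div, le_div_iff₀ (by positivity)]
        have h1 := mul_pow_le_pow_add_pow (a := |sampleRatio n l p.1 - 1|) (b := |φ p.2|)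
          (abs_nonneg _) (abs_nonneg _) (2 * s + 1)
        rw [show 2 * s + 1 + 1 = 2 * s + 2 by ring, hev.pow_abs, hev.pow_abs] at h1
        refine le_trans ?_ h1
        rw [pow_succ, mul_comm (|φ p.2| ^ (2 * s)), ← mul_assoc]
        have h2 : M ^ (2 * s) ≤ |φ p.2| ^ (2 * s) := pow_le_pow_left₀ hM.le (not_le.1 h).le _
        have h3 : (sampleRatio n l p.1 - 1) * φ p.2 ≤ |sampleRatio n l p.1 - 1| * |φ p.2| := by
          rw [← abs_mul]; exact le_abs_self _
        gcongr
    have hdi : Integrable (fun p : (Fin n → Obs) × 𝒯 =>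
        (sampleRatio n l p.1 - 1) * (φ p.2 - φM p.2)) (jointLaw ρ K) :=
      integrable_jointLaw_mul (K := K) (φ := fun t => φ t - φM t) (M := 1 + M) hL
        (hφ.sub hφMm) fun t => (abs_sub _ _).trans (add_le_add (hφ1 t) (hφMM t))
    have h1 := integral_mono hdi ((hsi'.add (hφk (2 * s + 2))).const_mul ((M ^ (2 * s))⁻¹)) hpt
    rw [integral_const_mul, integral_add' hsi' (hφk _)] at h1
    refine h1.trans ?_
    rw [inv_mul_eq_div]
    gcongr
    have h2 : (1 : ℝ) ≤ 2 ^ (2 * s + 2) := one_le_pow₀ one_le_two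
    have h3 : (2 : ℝ) ^ (2 * s + 3) = 2 ^ (2 * s + 2) + 2 ^ (2 * s + 2) := by ring
    rw [h3, add_mul]
    refine add_le_add (hV'.trans ?_) hX
    nlinarith
  have hsplit : Δ = ∫ p, (sampleRatio n l p.1 - 1) * φM p.2 ∂(jointLaw ρ K) +
      ∫ p, (sampleRatio n l p.1 - 1) * (φ p.2 - φM p.2) ∂(jointLaw ρ K) := by
    rw [← integral_add (integrable_jointLaw_mul (K := K) hL hφMm hφMM)
      (integrable_jointLaw_mul (K := K) (φ := fun t => φ t - φM t) (M := 1 + M) hL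
        (hφ.sub hφMm) fun t => (abs_sub _ _).trans (add_le_add (hφ1 t) (hφMM t)))]
    refine integral_congr_ae (Filter.Eventually.of_forall fun p => ?_)
    simp only; ring
  have h4 : (2 : ℝ) ^ (2 * s + 4) * V / M ^ (2 * s) = 2 * (2 ^ (2 * s + 3) * V / M ^ (2 * s)) := by
    ring
  have h5 : 0 ≤ 2 ^ (2 * s + 3) * V / M ^ (2 * s) := by positivity
  have h6 : 0 ≤ n * e₁ * δ * M := by
    have := he0.trans he₁; positivity
  rw [h4]
  nlinarith [sq_nonneg β]

end Step

/-! ### Likelihood ratios of the regression model -/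

section Model

lemma gaussianReal_eq_withDensity_exp (a : ℝ) :
    gaussianReal a 1 =
      (gaussianReal 0 1).withDensity (fun ξ => ENNReal.ofReal (Real.exp (a * ξ - a ^ 2 / 2))) := by
  rw [gaussianReal_of_var_ne_zero a one_ne_zero, gaussianReal_of_var_ne_zero 0 one_ne_zero,
    ← withDensity_mul _ (measurable_gaussianPDF _ _) (by fun_prop)]
  congr 1
  ext ξ
  simp only [Pi.mul_apply, gaussianPDF]
  rw [← ENNReal.ofReal_mul (gaussianPDFReal_nonneg _ _ _)]
  congr 1
  simp only [gaussianPDFReal, mul_assoc, ← Real.exp_add]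
  congr 2
  simp only [NNReal.coe_one]
  ring

lemma lintegral_gaussianReal_add (a : ℝ) {g : ℝ → ℝ≥0∞} (hg : Measurable g) :
    ∫⁻ ξ, g (ξ + a) ∂(gaussianReal 0 1) =
      ∫⁻ ξ, g ξ * ENNReal.ofReal (Real.exp (a * ξ - a ^ 2 / 2)) ∂(gaussianReal 0 1) := by
  have h := gaussianReal_map_add_const (μ := 0) (v := 1) a
  rw [zero_add, gaussianReal_eq_withDensity_exp a] at h
  rw [← lintegral_map hg (measurable_add_const a), h,
    lintegral_withDensity_eq_lintegral_mul _ (by fun_prop) hg]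
  simp only [Pi.mul_apply, mul_comm]

lemma integral_exp_mul_gaussianReal (a : ℝ) :
    ∫ ξ, Real.exp (a * ξ) ∂(gaussianReal 0 1) = Real.exp (a ^ 2 / 2) := by
  have h := congrFun (mgf_fun_id_gaussianReal (μ := 0) (v := 1)) a
  simp only [mgf, zero_mul, NNReal.coe_one, one_mul, zero_add] at h
  exact h

/-- The map that turns a covariate and a noise variable into an observation. -/
def obsMap (f : L2) (w : unitInterval × ℝ) : Obs := (f w.1 + w.2, w.1)

lemma measurable_coe_L2 (f : L2) : Measurable (f : unitInterval → ℝ) :=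
  (Lp.stronglyMeasurable f).measurable

lemma measurable_obsMap (f : L2) : Measurable (obsMap f) :=
  (((measurable_coe_L2 f).comp measurable_fst).add measurable_snd).prodMk measurable_fst

instance (f : L2) : IsProbabilityMeasure (obsLaw f) :=
  Measure.isProbabilityMeasure_map (measurable_obsMap f).aemeasurable

instance (n : ℕ) (f : L2) : IsProbabilityMeasure (sampleLaw n f) := by
  unfold sampleLaw; infer_instance

/-- The log-likelihood ratio of one observation when the regression function `f` is shifted by
`v`. -/
def logRatio (f : L2) (v : unitInterval → ℝ) (o : Obs) : ℝ :=
  v o.2 * (o.1 - f o.2) - v o.2 ^ 2 / 2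

variable {f : L2} {v : unitInterval → ℝ}

lemma measurable_logRatio (f : L2) (hv : Measurable v) : Measurable (logRatio f v) := by
  have := measurable_coe_L2 f
  unfold logRatio
  fun_prop

lemma logRatio_obsMap (w : unitInterval × ℝ) :
    logRatio f v (obsMap f w) = v w.1 * w.2 - v w.1 ^ 2 / 2 := by
  simp [logRatio, obsMap]

/-- Shifting the regression function by `v` multiplies the law of an observation by the Gaussian
likelihood ratio. -/
lemma obsLaw_eq_withDensity (hv : Measurable v) {f' : L2}
    (hf' : (f' : unitInterval → ℝ) =ᵐ[volume] fun x => f x + v x) :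
    obsLaw f' = (obsLaw f).withDensity fun o => ENNReal.ofReal (Real.exp (logRatio f v o)) := by
  have hlm := measurable_logRatio f hv
  have e : ∀ g : L2, obsLaw g = (volume.prod (gaussianReal 0 1)).map (obsMap g) := fun g => rfl
  ext s hs
  have hind : Measurable (s.indicator (1 : Obs → ℝ≥0∞)) := measurable_one.indicator hs
  rw [withDensity_apply _ hs, ← lintegral_indicator hs, e f,
    lintegral_map (by fun_prop (disch := assumption)) (measurable_obsMap f),
    ← lintegral_indicator_one hs, e f', lintegral_map hind (measurable_obsMap f'),
    lintegral_prod (fun w => s.indicator 1 (obsMap f' w))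
      (hind.comp (measurable_obsMap f')).aemeasurable, lintegral_prod]
  · refine lintegral_congr_ae ?_
    filter_upwards [hf'] with x hx
    have h := lintegral_gaussianReal_add (v x) (g := fun ξ => s.indicator 1 (f x + ξ, x))
      (hind.comp (by fun_prop))
    calc ∫⁻ ξ, s.indicator 1 (obsMap f' (x, ξ)) ∂(gaussianReal 0 1)
        = ∫⁻ ξ, s.indicator 1 (f x + (ξ + v x), x) ∂(gaussianReal 0 1) := by
          refine lintegral_congr fun ξ => ?_
          simp only [obsMap, hx]
          rw [add_assoc, add_comm (v x)]
      _ = _ := h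
      _ = _ := by
          refine lintegral_congr fun ξ => ?_
          by_cases hm : obsMap f (x, ξ) ∈ s
          · rw [Set.indicator_of_mem hm, Set.indicator_of_mem (by exact hm), logRatio_obsMap]
            simp
          · rw [Set.indicator_of_notMem hm, Set.indicator_of_notMem (by exact hm), zero_mul]
  · refine Measurable.aemeasurable ?_
    refine Measurable.comp (g := s.indicator fun o => ENNReal.ofReal (Real.exp (logRatio f v o)))
      (Measurable.indicator (by fun_prop) hs) (measurable_obsMap f)

lemma integrable_exp_noise (c : ℝ) :
    Integrable (fun w : unitInterval × ℝ => Real.exp (c * w.2))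
      (volume.prod (gaussianReal 0 1)) :=
  (integrable_exp_mul_gaussianReal (μ := 0) (v := 1) c).comp_snd _

lemma integrable_exp_mul_logRatio (hv : Measurable v) {a : ℝ} (ha : ∀ x, |v x| ≤ a) (c : ℝ) :
    Integrable (fun o => Real.exp (c * logRatio f v o)) (obsLaw f) := by
  have hlm := measurable_logRatio f hv
  refine (integrable_map_measure (by fun_prop) (measurable_obsMap f).aemeasurable).2 ?_
  have hdom := ((integrable_exp_noise (|c| * a)).add (integrable_exp_noise (-(|c| * a)))).const_mul
    (Real.exp (|c| * (a ^ 2 / 2)))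
  refine hdom.mono' ((by fun_prop : Measurable fun o => Real.exp (c * logRatio f v o)).comp
    (measurable_obsMap f)).aestronglyMeasurable (Filter.Eventually.of_forall fun w => ?_)
  simp only [Function.comp_apply, logRatio_obsMap, Real.norm_eq_abs, Real.abs_exp, Pi.add_apply]
  have ha0 : 0 ≤ a := (abs_nonneg _).trans (ha w.1)
  have h1 : c * (v w.1 * w.2 - v w.1 ^ 2 / 2) ≤ |c| * (a ^ 2 / 2) + |c| * a * |w.2| := by
    have h2 : c * (v w.1 * w.2) ≤ |c| * a * |w.2| := by
      refine (le_abs_self _).trans ?_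
      rw [abs_mul, abs_mul, mul_assoc]
      gcongr
      exact ha _
    have h3 : -(c * (v w.1 ^ 2 / 2)) ≤ |c| * (a ^ 2 / 2) := by
      rw [← neg_mul]
      have : v w.1 ^ 2 ≤ a ^ 2 := sq_le_sq' (abs_le.1 (ha _)).1 (abs_le.1 (ha _)).2
      gcongr
      exact neg_le_abs c
    rw [mul_sub]; linarith
  refine (Real.exp_le_exp.2 h1).trans ?_
  rw [Real.exp_add]
  gcongr
  rcases le_total 0 w.2 with h | h
  · rw [abs_of_nonneg h]; linarith [Real.exp_pos (-(|c| * a) * w.2)]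
  · rw [abs_of_nonpos h, mul_neg, ← neg_mul]; linarith [Real.exp_pos (|c| * a * w.2)]

lemma integral_exp_mul_logRatio (hv : Measurable v) {a : ℝ} (ha : ∀ x, |v x| ≤ a) (c : ℝ) :
    ∫ o, Real.exp (c * logRatio f v o) ∂(obsLaw f) =
      ∫ x, Real.exp ((c ^ 2 - c) * (v x ^ 2 / 2)) := by
  have hlm := measurable_logRatio f hv
  have hi := integrable_exp_mul_logRatio (f := f) hv ha c
  have hi' := (integrable_map_measure (by fun_prop) (measurable_obsMap f).aemeasurable).1 hi
  refine (integral_map (measurable_obsMap f).aemeasurable (by fun_prop)).trans ?_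
  refine (integral_prod _ hi').trans ?_
  simp only [Function.comp_apply, logRatio_obsMap]
  refine integral_congr_ae (Filter.Eventually.of_forall fun x => ?_)
  simp only
  have : ∀ ξ : ℝ, Real.exp (c * (v x * ξ - v x ^ 2 / 2)) =
      Real.exp (-(c * (v x ^ 2 / 2))) * Real.exp (c * v x * ξ) := fun ξ => by
    rw [← Real.exp_add]; ring_nf
  simp_rw [this]
  rw [integral_const_mul, integral_exp_mul_gaussianReal, ← Real.exp_add]
  congr 1; ring

lemma integrable_of_abs_le_unitInterval {g : unitInterval → ℝ} (hg : Measurable g) {C : ℝ}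
    (hC : ∀ x, |g x| ≤ C) : Integrable g volume :=
  Integrable.of_bound hg.aestronglyMeasurable C (Filter.Eventually.of_forall hC)

lemma integral_exp_mul_logRatio_le (hv : Measurable v) {a : ℝ} (ha : ∀ x, |v x| ≤ a) (c : ℝ) :
    ∫ o, Real.exp (c * logRatio f v o) ∂(obsLaw f) ≤ Real.exp ((c ^ 2 + |c|) * (a ^ 2 / 2)) := by
  rw [integral_exp_mul_logRatio hv ha c]
  have hpt : ∀ x, Real.exp ((c ^ 2 - c) * (v x ^ 2 / 2)) ≤
      Real.exp ((c ^ 2 + |c|) * (a ^ 2 / 2)) := fun x => by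
    have : v x ^ 2 ≤ a ^ 2 := sq_le_sq' (abs_le.1 (ha _)).1 (abs_le.1 (ha _)).2
    have h1 : c ^ 2 - c ≤ c ^ 2 + |c| := by linarith [neg_le_abs c]
    gcongr
  have hi : Integrable (fun x => Real.exp ((c ^ 2 - c) * (v x ^ 2 / 2))) :=
    integrable_of_abs_le_unitInterval (by fun_prop)
      (fun x => by rw [Real.abs_exp]; exact hpt x)
  refine (integral_mono hi (integrable_const _) hpt).trans ?_
  simp

lemma integral_exp_logRatio (hv : Measurable v) {a : ℝ} (ha : ∀ x, |v x| ≤ a) :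
    ∫ o, Real.exp (logRatio f v o) ∂(obsLaw f) = 1 := by
  have := integral_exp_mul_logRatio (f := f) hv ha 1
  simpa using this

lemma integral_exp_logRatio_sq_le (hv : Measurable v) {a : ℝ} (ha : ∀ x, |v x| ≤ a) (ha1 : a ≤ 1) :
    ∫ o, Real.exp (logRatio f v o) ^ 2 ∂(obsLaw f) ≤ 1 + 2 * ∫ x, v x ^ 2 := by
  have h2 : ∀ o, Real.exp (logRatio f v o) ^ 2 = Real.exp (2 * logRatio f v o) := fun o => by
    rw [← Real.exp_nat_mul]; norm_num
  simp_rw [h2]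
  rw [integral_exp_mul_logRatio hv ha 2]
  have hv1 : ∀ x, v x ^ 2 ≤ 1 := fun x => by
    rw [← sq_abs]; exact pow_le_one₀ (abs_nonneg _) ((ha x).trans ha1)
  have hvi : Integrable fun x => v x ^ 2 :=
    integrable_of_abs_le_unitInterval (by fun_prop) (C := 1) fun x => by
      rw [abs_of_nonneg (sq_nonneg _)]; exact hv1 x
  have hpt : ∀ x, Real.exp ((2 ^ 2 - 2) * (v x ^ 2 / 2)) ≤ 1 + 2 * v x ^ 2 := fun x => by
    have := Real.abs_exp_sub_one_le (x := v x ^ 2)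
      (by rw [abs_of_nonneg (sq_nonneg _)]; exact hv1 x)
    rw [abs_of_nonneg (sq_nonneg (v x))] at this
    have h3 := (le_abs_self _).trans this
    have h4 : ((2 : ℝ) ^ 2 - 2) * (v x ^ 2 / 2) = v x ^ 2 := by ring
    rw [h4]; linarith
  have hi : Integrable (fun x => Real.exp ((2 ^ 2 - 2) * (v x ^ 2 / 2))) :=
    integrable_of_abs_le_unitInterval (by fun_prop) (C := 3)
      (fun x => by rw [Real.abs_exp]; linarith [hpt x, hv1 x])
  refine (integral_mono hi ((integrable_const 1).add (hvi.const_mul 2)) hpt).trans (le_of_eq ?_)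
  rw [integral_add' (integrable_const 1) (hvi.const_mul 2), integral_const_mul]
  simp

lemma integral_abs_exp_sub_one_gaussianReal_le {a : ℝ} (ha : |a| ≤ 1) :
    ∫ ξ, |Real.exp (a * ξ - a ^ 2 / 2) - 1| ∂(gaussianReal 0 1) ≤ 2 * |a| := by
  rcases eq_or_ne a 0 with rfl | h0
  · simp
  have ha0 : 0 < |a| := abs_pos.2 h0
  have hi : ∀ c : ℝ, Integrable (fun ξ => Real.exp (c * ξ)) (gaussianReal 0 1) := fun c =>
    integrable_exp_mul_gaussianReal c
  have i2 := (hi (2 * a)).const_mul (Real.exp (-a ^ 2))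
  have i1 := (hi a).const_mul (2 * Real.exp (-(a ^ 2 / 2)))
  have hsq : ∀ ξ, (Real.exp (a * ξ - a ^ 2 / 2) - 1) ^ 2 = Real.exp (-a ^ 2) * Real.exp (2 * a * ξ)
      - 2 * Real.exp (-(a ^ 2 / 2)) * Real.exp (a * ξ) + 1 := fun ξ => by
    have h1 : Real.exp (a * ξ - a ^ 2 / 2) ^ 2 = Real.exp (-a ^ 2) * Real.exp (2 * a * ξ) := by
      rw [← Real.exp_nat_mul, ← Real.exp_add]; push_cast; ring_nf
    have h2 : Real.exp (a * ξ - a ^ 2 / 2) = Real.exp (-(a ^ 2 / 2)) * Real.exp (a * ξ) := by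
      rw [← Real.exp_add]; ring_nf
    rw [sub_sq, h1, h2]; ring
  have isq : Integrable (fun ξ => (Real.exp (a * ξ - a ^ 2 / 2) - 1) ^ 2) (gaussianReal 0 1) := by
    simp_rw [hsq]; exact (i2.sub i1).add (integrable_const 1)
  have hval : ∫ ξ, (Real.exp (a * ξ - a ^ 2 / 2) - 1) ^ 2 ∂(gaussianReal 0 1) =
      Real.exp (a ^ 2) - 1 := by
    simp_rw [hsq]
    have i21 : Integrable (fun ξ => Real.exp (-a ^ 2) * Real.exp (2 * a * ξ)
      - 2 * Real.exp (-(a ^ 2 / 2)) * Real.exp (a * ξ)) (gaussianReal 0 1) := i2.sub i1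
    rw [integral_add i21 (integrable_const 1), integral_sub i2 i1,
      integral_const_mul, integral_const_mul, integral_exp_mul_gaussianReal,
      integral_exp_mul_gaussianReal, mul_assoc, ← Real.exp_add, ← Real.exp_add]
    simp only [neg_add_cancel, Real.exp_zero, integral_const, probReal_univ, smul_eq_mul]
    ring_nf
  have hexp : Real.exp (a ^ 2) - 1 ≤ 2 * a ^ 2 := by
    have := Real.abs_exp_sub_one_le (x := a ^ 2)
      (by rw [abs_pow]; exact pow_le_one₀ (abs_nonneg _) ha)
    rw [abs_of_nonneg (sq_nonneg a)] at this
    exact (le_abs_self _).trans this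
  -- `|y| ≤ y² / (2|a|) + |a| / 2`
  have hpt : ∀ ξ, |Real.exp (a * ξ - a ^ 2 / 2) - 1| ≤
      (2 * |a|)⁻¹ * (Real.exp (a * ξ - a ^ 2 / 2) - 1) ^ 2 + |a| / 2 := fun ξ => by
    rw [inv_mul_eq_div, div_add_div _ _ (by positivity) two_ne_zero, le_div_iff₀ (by positivity)]
    nlinarith [sq_nonneg (|Real.exp (a * ξ - a ^ 2 / 2) - 1| - |a|),
      sq_abs (Real.exp (a * ξ - a ^ 2 / 2) - 1)]
  refine (integral_mono_of_nonneg (Filter.Eventually.of_forall fun ξ => abs_nonneg _)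
    ((isq.const_mul _).add (integrable_const _)) (Filter.Eventually.of_forall hpt)).trans ?_
  rw [integral_add' (isq.const_mul _) (integrable_const _), integral_const_mul, hval]
  simp only [integral_const, probReal_univ, smul_eq_mul, one_mul]
  have : (2 * |a|)⁻¹ * (Real.exp (a ^ 2) - 1) ≤ |a| := by
    rw [inv_mul_le_iff₀ (by positivity)]
    refine hexp.trans (le_of_eq ?_)
    rw [← sq_abs]; ring
  linarith

/-- The total variation distance of the laws of one observation is at most of the order of the `L₁`
norm of the shift. For a localized shift this is much smaller than its `L₂` norm. -/
lemma integral_abs_exp_logRatio_sub_one_le (hv : Measurable v) (ha : ∀ x, |v x| ≤ 1) :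
    ∫ o, |Real.exp (logRatio f v o) - 1| ∂(obsLaw f) ≤ 2 * ∫ x, |v x| := by
  have hlm := measurable_logRatio f hv
  have hi : Integrable (fun o => |Real.exp (logRatio f v o) - 1|) (obsLaw f) := by
    have := integrable_exp_mul_logRatio (f := f) hv ha 1
    simp only [one_mul] at this
    exact (this.sub (integrable_const 1)).abs
  have hi' := (integrable_map_measure (by fun_prop) (measurable_obsMap f).aemeasurable).1 hi
  have e : ∫ o, |Real.exp (logRatio f v o) - 1| ∂(obsLaw f) =
      ∫ x, ∫ ξ, |Real.exp (v x * ξ - v x ^ 2 / 2) - 1| ∂(gaussianReal 0 1) := by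
    refine (integral_map (measurable_obsMap f).aemeasurable (by fun_prop)).trans ?_
    refine (integral_prod _ hi').trans ?_
    simp only [Function.comp_apply, logRatio_obsMap]
  rw [e, ← integral_const_mul]
  refine integral_mono_of_nonneg
    (Filter.Eventually.of_forall fun x => integral_nonneg fun ξ => abs_nonneg _)
    ((integrable_of_abs_le_unitInterval hv ha).abs.const_mul 2)
    (Filter.Eventually.of_forall fun x => integral_abs_exp_sub_one_gaussianReal_le (ha x))

end Model

/-! ### Moments of the sample likelihood ratio -/

section SampleMoments

variable {f : L2} {v : unitInterval → ℝ} {n : ℕ}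

lemma sampleRatio_exp (g : Obs → ℝ) (z : Fin n → Obs) :
    sampleRatio n (fun o => Real.exp (g o)) z = Real.exp (∑ i, g (z i)) := by
  rw [sampleRatio, Real.exp_sum]

lemma integral_exp_mul_sum_logRatio_le (hv : Measurable v) {a : ℝ} (ha : ∀ x, |v x| ≤ a) (c : ℝ) :
    Integrable (fun z : Fin n → Obs => Real.exp (c * ∑ i, logRatio f v (z i))) (sampleLaw n f) ∧
    ∫ z : Fin n → Obs, Real.exp (c * ∑ i, logRatio f v (z i)) ∂(sampleLaw n f) ≤
      Real.exp (n * ((c ^ 2 + |c|) * (a ^ 2 / 2))) := by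
  have e : ∀ z : Fin n → Obs, Real.exp (c * ∑ i, logRatio f v (z i)) =
      ∏ i, (fun o => Real.exp (c * logRatio f v o)) (z i) := fun z => by
    rw [Finset.mul_sum, Real.exp_sum]
  simp_rw [e]
  refine ⟨Integrable.fintype_prod (μ := fun _ => obsLaw f)
    (fun _ => integrable_exp_mul_logRatio hv ha c), ?_⟩
  have h := integral_fintype_prod_eq_pow (ι := Fin n) (μ := obsLaw f)
    (fun o => Real.exp (c * logRatio f v o))
  rw [sampleLaw, h, Fintype.card_fin, Real.exp_nat_mul]
  exact pow_le_pow_left₀ (integral_nonneg fun _ => (Real.exp_pos _).le)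
    (integral_exp_mul_logRatio_le hv ha c) n

lemma abs_exp_sub_one_le_mul_exp (x : ℝ) : |Real.exp x - 1| ≤ |x| * Real.exp |x| := by
  rcases le_total 0 x with h | h
  · rw [abs_of_nonneg (sub_nonneg.2 (Real.one_le_exp h)), abs_of_nonneg h]
    have h1 := Real.add_one_le_exp (-x)
    have h2 : Real.exp x * Real.exp (-x) = 1 := by rw [← Real.exp_add]; simp
    nlinarith [Real.exp_pos x]
  · rw [abs_of_nonpos (sub_nonpos.2 (Real.exp_le_one_iff.2 h)), abs_of_nonpos h]
    have h1 := Real.add_one_le_exp x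
    have h2 := Real.one_le_exp (neg_nonneg.2 h)
    nlinarith

/-- Even powers of `eˣ - 1` are dominated by exponentials, with a small factor `c ^ (-k)`. -/
lemma exp_sub_one_pow_le {k : ℕ} (hk : Even k) {c : ℝ} (hc : 0 < c) (hkc : (k : ℝ) ≤ c) (x : ℝ) :
    (Real.exp x - 1) ^ k ≤
      k.factorial / c ^ k * (Real.exp (2 * c * x) + Real.exp (-(2 * c) * x)) := by
  have h1 : (Real.exp x - 1) ^ k ≤ (|x| * Real.exp |x|) ^ k := by
    rw [← hk.pow_abs]; exact pow_le_pow_left₀ (abs_nonneg _) (abs_exp_sub_one_le_mul_exp x) k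
  have h2 := Real.pow_div_factorial_le_exp (c * |x|) (by positivity) k
  have hf : (0 : ℝ) < k.factorial := by exact_mod_cast k.factorial_pos
  rw [div_le_iff₀ hf, mul_pow] at h2
  have h3 : Real.exp (c * |x|) * Real.exp |x| ^ k ≤ Real.exp (2 * c * x) + Real.exp (-(2 * c) * x) := by
    rw [← Real.exp_nat_mul, ← Real.exp_add]
    have h4 : c * |x| + k * |x| ≤ 2 * c * |x| := by nlinarith [abs_nonneg x]
    refine (Real.exp_le_exp.2 h4).trans ?_
    rcases le_total 0 x with h | h
    · rw [abs_of_nonneg h]; linarith [Real.exp_pos (-(2 * c) * x)]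
    · rw [abs_of_nonpos h, mul_neg, ← neg_mul]; linarith [Real.exp_pos (2 * c * x)]
  refine h1.trans ?_
  rw [mul_pow, div_mul_eq_mul_div, le_div_iff₀ (by positivity)]
  calc |x| ^ k * Real.exp |x| ^ k * c ^ k = (c ^ k * |x| ^ k) * Real.exp |x| ^ k := by ring
    _ ≤ (Real.exp (c * |x|) * k.factorial) * Real.exp |x| ^ k := by gcongr
    _ = k.factorial * (Real.exp (c * |x|) * Real.exp |x| ^ k) := by ring
    _ ≤ _ := by gcongr

/-- The moments of `L - 1`, for `L` the likelihood ratio of a sample of size `n`, are those of a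
centred normal variable of variance `n a²`, up to constants. -/
lemma integral_sampleRatio_sub_one_pow_le (hn : 0 < n) (hv : Measurable v) {a : ℝ} (ha0 : 0 < a)
    (ha : ∀ x, |v x| ≤ a) {k : ℕ} (hk : Even k) (hk1 : 1 ≤ k) (hka : k * (a * √n) ≤ 1) :
    Integrable (fun z => (sampleRatio n (fun o => Real.exp (logRatio f v o)) z - 1) ^ k)
      (sampleLaw n f) ∧
    ∫ z, (sampleRatio n (fun o => Real.exp (logRatio f v o)) z - 1) ^ k ∂(sampleLaw n f) ≤
      2 * Real.exp 3 * k.factorial * (a * √n) ^ k := by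
  have hn' : (0 : ℝ) < √n := Real.sqrt_pos.2 (by exact_mod_cast hn)
  have hb : 0 < a * √n := mul_pos ha0 hn'
  set c : ℝ := (a * √n)⁻¹ with hc
  have hc0 : 0 < c := inv_pos.2 hb
  have hcb : c * (a * √n) = 1 := inv_mul_cancel₀ hb.ne'
  have hkc : (k : ℝ) ≤ c := by rw [hc, ← one_div, le_div_iff₀ hb]; exact hka
  have hb1 : a * √n ≤ 1 := by
    refine le_trans ?_ hka
    have : (1 : ℝ) ≤ k := by exact_mod_cast hk1
    nlinarith
  have hlm := measurable_logRatio f hv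
  simp_rw [sampleRatio_exp]
  have hpt := fun z : Fin n → Obs =>
    exp_sub_one_pow_le hk hc0 hkc (∑ i, logRatio f v (z i))
  obtain ⟨i1, b1⟩ := integral_exp_mul_sum_logRatio_le (n := n) (f := f) hv ha (2 * c)
  obtain ⟨i2, b2⟩ := integral_exp_mul_sum_logRatio_le (n := n) (f := f) hv ha (-(2 * c))
  have hdom := (i1.add i2).const_mul (k.factorial / c ^ k)
  have hint : Integrable (fun z : Fin n → Obs => (Real.exp (∑ i, logRatio f v (z i)) - 1) ^ k)
      (sampleLaw n f) := by
    refine hdom.mono' (Measurable.aestronglyMeasurable (by fun_prop))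
      (Filter.Eventually.of_forall fun z => ?_)
    rw [Real.norm_eq_abs, abs_of_nonneg (hk.pow_nonneg _)]
    exact hpt z
  refine ⟨hint, (integral_mono hint hdom hpt).trans ?_⟩
  rw [integral_const_mul, integral_add' i1 i2]
  -- with `c = 1 / (a √n)` the exponents are at most `3`
  have hexp : n * (((2 * c) ^ 2 + |2 * c|) * (a ^ 2 / 2)) ≤ 3 := by
    rw [abs_of_pos (by positivity)]
    have hs : √(n : ℝ) ^ 2 = n := Real.sq_sqrt n.cast_nonneg
    have e : n * (((2 * c) ^ 2 + 2 * c) * (a ^ 2 / 2)) =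
        2 * (c * (a * √n)) ^ 2 + (c * (a * √n)) * (a * √n) := by
      have e' : 2 * (c * (a * √n)) ^ 2 + (c * (a * √n)) * (a * √n) =
          (2 * c ^ 2 * a ^ 2 + c * a ^ 2) * √(n : ℝ) ^ 2 := by ring
      rw [e', hs]; ring
    rw [e, hcb]; linarith
  have hexp' : n * (((-(2 * c)) ^ 2 + |-(2 * c)|) * (a ^ 2 / 2)) ≤ 3 := by
    rwa [neg_sq, abs_neg]
  have hc' : k.factorial / c ^ k = k.factorial * (a * √n) ^ k := by
    rw [hc, inv_pow, div_inv_eq_mul]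
  have h1 := b1.trans (Real.exp_le_exp.2 hexp)
  have h2 := b2.trans (Real.exp_le_exp.2 hexp')
  rw [hc']
  calc _ ≤ k.factorial * (a * √n) ^ k * (Real.exp 3 + Real.exp 3) := by gcongr
    _ = _ := by ring

lemma integral_exp_logRatio_sq_pow_le (hv : Measurable v) {a : ℝ} (ha : ∀ x, |v x| ≤ a)
    (ha1 : a ≤ 1) {η : ℝ} (hη : ∫ x, v x ^ 2 ≤ η ^ 2) (hn : 2 * n * η ^ 2 ≤ 1) :
    (∫ o, Real.exp (logRatio f v o) ^ 2 ∂(obsLaw f)) ^ n ≤ 1 + 4 * n * η ^ 2 := by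
  have h1 : ∫ o, Real.exp (logRatio f v o) ^ 2 ∂(obsLaw f) ≤ Real.exp (2 * η ^ 2) := by
    have h2 := integral_exp_logRatio_sq_le (f := f) hv ha ha1
    have h3 := Real.add_one_le_exp (2 * η ^ 2)
    linarith
  have h2 := pow_le_pow_left₀ (integral_nonneg fun _ => sq_nonneg _) h1 n
  rw [← Real.exp_nat_mul] at h2
  have hnn : 0 ≤ n * (2 * η ^ 2) := by positivity
  have h3 := Real.abs_exp_sub_one_le (x := n * (2 * η ^ 2))
    (by rw [abs_of_nonneg hnn]; linarith)
  rw [abs_of_nonneg hnn] at h3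
  have h4 := (le_abs_self _).trans h3
  linarith

lemma integral_sampleRatio_sub_one_sq_le (hv : Measurable v) {a : ℝ} (ha : ∀ x, |v x| ≤ a)
    (ha1 : a ≤ 1) {η : ℝ} (hη : ∫ x, v x ^ 2 ≤ η ^ 2) (hn : 2 * n * η ^ 2 ≤ 1) :
    Integrable (fun z => (sampleRatio n (fun o => Real.exp (logRatio f v o)) z - 1) ^ 2)
      (sampleLaw n f) ∧
    ∫ z, (sampleRatio n (fun o => Real.exp (logRatio f v o)) z - 1) ^ 2 ∂(sampleLaw n f) ≤
      4 * n * η ^ 2 := by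
  have hi1 : Integrable (fun o => Real.exp (logRatio f v o)) (obsLaw f) := by
    simpa using integrable_exp_mul_logRatio (f := f) hv ha 1
  have hi2 : Integrable (fun o => Real.exp (logRatio f v o) ^ 2) (obsLaw f) := by
    have := integrable_exp_mul_logRatio (f := f) hv ha 2
    refine this.congr (Filter.Eventually.of_forall fun o => ?_)
    simp only
    rw [← Real.exp_nat_mul]; norm_num
  set l : Obs → ℝ := fun o => Real.exp (logRatio f v o) with hl
  have e : ∀ z : Fin n → Obs, (sampleRatio n l z - 1) ^ 2 =
      (sampleRatio n (fun o => l o ^ 2) z - 2 * sampleRatio n l z) + 1 := fun z => by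
    simp only [sampleRatio, Finset.prod_pow]; ring
  have j1 := integrable_sampleRatio (n := n) hi1
  have j2 := integrable_sampleRatio (n := n) hi2
  have j3 : Integrable (fun z => sampleRatio n (fun o => l o ^ 2) z - 2 * sampleRatio n l z)
    (Measure.pi fun _ => obsLaw f) := j2.sub (j1.const_mul 2)
  simp_rw [e]
  refine ⟨j3.add (integrable_const 1), ?_⟩
  rw [sampleLaw, integral_add j3 (integrable_const 1), integral_sub j2 (j1.const_mul 2),
    integral_const_mul]
  have e1 := integral_fintype_prod_eq_pow (ι := Fin n) (μ := obsLaw f) l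
  have e2 := integral_fintype_prod_eq_pow (ι := Fin n) (μ := obsLaw f) (fun o => l o ^ 2)
  rw [integral_exp_logRatio hv ha, one_pow] at e1
  have h := integral_exp_logRatio_sq_pow_le (f := f) hv ha ha1 hη hn
  rw [Fintype.card_fin] at e2
  simp only [sampleRatio]
  rw [e1, e2]
  simp only [integral_const, probReal_univ, smul_eq_mul]
  linarith

end SampleMoments

/-! ### The Hellinger distance along a direction of the function space -/

section Direction

variable {𝒯 : Type*} [MeasurableSpace 𝒯] {n : ℕ} {K : Kernel (Fin n → Obs) 𝒯} [IsMarkovKernel K]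
  {ψ : L2} {u : unitInterval → ℝ}

lemma sampleLaw_add_smul (hu : Measurable u) (hψ : (ψ : unitInterval → ℝ) =ᵐ[volume] u) (f : L2)
    (η : ℝ) :
    sampleLaw n (f + η • ψ) = Measure.pi fun _ => (obsLaw f).withDensity
      fun o => ENNReal.ofReal (Real.exp (logRatio f (fun x => η * u x) o)) := by
  rw [sampleLaw, obsLaw_eq_withDensity (f := f) (v := fun x => η * u x) (by fun_prop)]
  filter_upwards [Lp.coeFn_add f (η • ψ), Lp.coeFn_smul η ψ, hψ] with x h1 h2 h3
  rw [h1, Pi.add_apply, h2, Pi.smul_apply, h3, smul_eq_mul]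

/-- A step of length `η` in a direction of norm at most one, with the information bounded by the
sample size. -/
lemma discriminationLE_nonprivate (hu : Measurable u) (hψ : (ψ : unitInterval → ℝ) =ᵐ[volume] u)
    {b : ℝ} (hb : ∀ x, |u x| ≤ b) (hu2 : ∫ x, u x ^ 2 ≤ 1) (f : L2) {η : ℝ} (hη : 0 < η)
    (hηb : η * b ≤ 1) (hηn : 2 * n * η ^ 2 ≤ 1) :
    DiscriminationLE ((sampleLaw n f).bind K) ((sampleLaw n (f + η • ψ)).bind K)
      (4 * n * η ^ 2) := by
  have hv : Measurable fun x => η * u x := by fun_prop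
  have ha : ∀ x, |η * u x| ≤ η * b := fun x => by
    rw [abs_mul, abs_of_pos hη]; gcongr; exact hb x
  have hη2 : ∫ x, (η * u x) ^ 2 ≤ η ^ 2 := by
    simp_rw [mul_pow]
    rw [integral_const_mul]
    nlinarith [sq_nonneg η]
  obtain ⟨h1, h2⟩ := integral_sampleRatio_sub_one_sq_le (f := f) (n := n) hv ha hηb hη2 hηn
  rw [sampleLaw_add_smul hu hψ]
  have hi1 : Integrable (fun o => Real.exp (logRatio f (fun x => η * u x) o)) (obsLaw f) := by
    simpa using integrable_exp_mul_logRatio (f := f) hv ha 1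
  have := discriminationLE_of_integral_sq (K := K) (measurable_logRatio f hv).exp
    (fun _ => (Real.exp_pos _).le) hi1 h1
  exact fun φ hφ hφ1 hs => (this φ hφ hφ1 hs).trans h2

/-- A step of length `η` under privacy. The test function is truncated at the level `η b √n Λ`,
where `η b √n` bounds the typical size of the likelihood ratio of the sample minus one, and `Λ` is
still to be chosen. -/
lemma discriminationLE_private {ε δ : ℝ} (hε : 0 ≤ ε) (hδ : 0 ≤ δ) (hK : IsDP ε δ K) (hn : 0 < n)
    (hu : Measurable u) (hψ : (ψ : unitInterval → ℝ) =ᵐ[volume] u) {b τ : ℝ} (hb0 : 0 < b)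
    (hb : ∀ x, |u x| ≤ b) (hτ : ∫ x, |u x| ≤ τ) (hu2 : ∫ x, u x ^ 2 ≤ 1) (s : ℕ) {Λ : ℝ}
    (hΛ : 0 < Λ) (f : L2) {η : ℝ} (hη : 0 < η)
    (hηb : η * b ≤ 1) (hηn : 2 * n * η ^ 2 ≤ 1) (hηs : (2 * s + 2) * (η * b * √n) ≤ 1) :
    DiscriminationLE ((sampleLaw n f).bind K) ((sampleLaw n (f + η • ψ)).bind K)
      ((32 * (n * τ * (Real.exp ε - 1)) ^ 2 + 8 * (n * τ * δ * (b * √n * Λ)) +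
        2 ^ (2 * s + 5) * Real.exp 3 * (2 * s + 2).factorial * (n * b ^ 2) / Λ ^ (2 * s)) *
          η ^ 2) := by
  have hv : Measurable fun x => η * u x := by fun_prop
  have ha : ∀ x, |η * u x| ≤ η * b := fun x => by
    rw [abs_mul, abs_of_pos hη]; gcongr; exact hb x
  have hη2 : ∫ x, (η * u x) ^ 2 ≤ η ^ 2 := by
    simp_rw [mul_pow]
    rw [integral_const_mul]
    nlinarith [sq_nonneg η]
  rw [sampleLaw_add_smul hu hψ]
  obtain ⟨hsi, hV⟩ := integral_sampleRatio_sub_one_pow_le (f := f) hn hv (mul_pos hη hb0) ha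
    (k := 2 * s + 2) ⟨s + 1, by ring⟩ (by omega) (by push_cast; exact hηs)
  have h4 := integral_exp_logRatio_sq_pow_le (f := f) (n := n) hv ha hηb hη2 hηn
  have he₁ := integral_abs_exp_logRatio_sub_one_le (f := f) hv (fun x => (ha x).trans hηb)
  have hτ' : 2 * ∫ x, |η * u x| ≤ 2 * η * τ := by
    simp_rw [abs_mul, abs_of_pos hη]
    rw [integral_const_mul]
    nlinarith
  have hn' : (0 : ℝ) < √n := Real.sqrt_pos.2 (by exact_mod_cast hn)
  have hi2 : Integrable (fun o => Real.exp (logRatio f (fun x => η * u x) o) ^ 2) (obsLaw f) := by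
    refine (integrable_exp_mul_logRatio (f := f) hv ha 2).congr
      (Filter.Eventually.of_forall fun o => ?_)
    simp only
    rw [← Real.exp_nat_mul]; norm_num
  have hM : 0 < η * b * √n * Λ := by positivity
  have := discriminationLE_of_isDP (K := K) hε hδ hK (measurable_logRatio f hv).exp
    (fun _ => (Real.exp_pos _).le) (integral_exp_logRatio hv ha) hi2 (h4.trans (by linarith))
    (he₁.trans hτ') hsi hV hM
  refine fun φ hφ hφ1 hs => (this φ hφ hφ1 hs).trans (le_of_eq ?_)
  have hs2 : √(n : ℝ) ^ 2 = n := Real.sq_sqrt n.cast_nonneg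
  have e1 : 2 ^ (2 * s + 4) * (2 * Real.exp 3 * (2 * s + 2).factorial *
      (η * b * √n) ^ (2 * s + 2)) / (η * b * √n * Λ) ^ (2 * s) =
      2 ^ (2 * s + 5) * Real.exp 3 * (2 * s + 2).factorial * (n * b ^ 2) / Λ ^ (2 * s) * η ^ 2 := by
    have hnb : (n : ℝ) * b ^ 2 = √(n : ℝ) ^ 2 * b ^ 2 := by rw [hs2]
    rw [mul_pow (η * b * √n) Λ, hnb, pow_add (η * b * √n) (2 * s) 2]
    have : (η * b * √n) ^ (2 * s) ≠ 0 := by positivity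
    field_simp
    ring
  rw [e1]
  ring

/-- Splitting a segment of the function space into short steps turns a bound for the discrimination
of short steps into a bound for the Hellinger distance of its ends. -/
lemma hellingerSqLE_of_step {T r η₀ : ℝ} (hT : 0 < T) (hη₀ : 0 < η₀)
    (h : ∀ (f : L2) (η : ℝ), 0 < η → η ≤ η₀ →
      DiscriminationLE ((sampleLaw n f).bind K) ((sampleLaw n (f + η • ψ)).bind K) (r * η ^ 2))
    (f : L2) : HellingerSqLE ((sampleLaw n f).bind K) ((sampleLaw n (f + T • ψ)).bind K)
      (r * T ^ 2) := by
  obtain ⟨N, hN⟩ := exists_nat_gt (T / η₀)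
  have hN0 : (0 : ℝ) < N := (div_pos hT hη₀).trans hN
  have hη : T / N ≤ η₀ := by
    rw [div_lt_iff₀ hη₀] at hN
    rw [div_le_iff₀ hN0]; linarith
  have hpr : ∀ g : L2, IsProbabilityMeasure ((sampleLaw n g).bind K) := fun g => inferInstance
  have := HellingerSqLE.of_chain (P := fun i : ℕ => (sampleLaw n (f + (i * (T / N)) • ψ)).bind K)
    (N := N) (r := r * (T / N) ^ 2) fun i _ => by
      have h1 := h (f + (i * (T / N)) • ψ) (T / N) (div_pos hT hN0) hη
      have e : f + ((i + 1 : ℕ) * (T / N)) • ψ = f + (i * (T / N)) • ψ + (T / N) • ψ := by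
        rw [add_assoc, ← add_smul]; push_cast; ring_nf
      simp only [e]
      exact h1
  have e1 : (N : ℝ) * (T / N) = T := by field_simp
  have e2 : (N : ℝ) ^ 2 * (r * (T / N) ^ 2) = r * T ^ 2 := by field_simp
  simpa [e1, e2] using this

end Direction

/-! ### The information of one server about one coefficient -/

section Server

universe w

/-- The numerical part of the bound under privacy. With `y = √n ε² / d` the truncation level
`Λ = y ^ (-κ)` makes all three contributions at most of the order `n² ε² / d`. -/
lemma private_rate_le {B G Cε Cδ κ d D₁ ε δ : ℝ} {n s : ℕ} (hB : 0 < B) (hG : 0 < G)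
    (hCδ : 0 < Cδ) (hκ : 0 < κ) (hs : 3 ≤ κ * (2 * s)) (hD₁ : 0 < D₁) (hd : 0 < d)
    (hdG : d ≤ G * D₁) (hn : 0 < n) (hε : 0 < ε) (hεC : ε ≤ Cε)
    (hδC : δ ≤ Cδ * ((n : ℝ) ^ (1 / 2 : ℝ) * ε ^ 2 * D₁⁻¹) ^ (1 + κ)) (hnd : n * ε ^ 2 ≤ d)
    {c : ℝ} (hc : 0 < c) :
    ∃ Λ : ℝ, 0 < Λ ∧
      32 * (n * (B / √d) * (Real.exp ε - 1)) ^ 2 +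
        8 * (n * (B / √d) * δ * ((B * √d) * √n * Λ)) + c * (n * (B * √d) ^ 2) / Λ ^ (2 * s) ≤
      (32 * B ^ 2 * Real.exp Cε ^ 2 + 8 * B ^ 2 * Cδ * G ^ (1 + κ) + c * B ^ 2 * Cε ^ 2) *
        (n ^ 2 * ε ^ 2 / d) := by
  have hn1 : (1 : ℝ) ≤ n := by exact_mod_cast hn
  have hsd : 0 < √d := Real.sqrt_pos.2 hd
  have hsd2 : √d ^ 2 = d := Real.sq_sqrt hd.le
  have hsn : 1 ≤ √(n : ℝ) := Real.one_le_sqrt.2 hn1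
  have hsn2 : √(n : ℝ) ^ 2 = n := Real.sq_sqrt n.cast_nonneg
  rw [← Real.sqrt_eq_rpow] at hδC
  set y : ℝ := √n * ε ^ 2 / d with hy
  have hy0 : 0 < y := by positivity
  have hy1 : y ≤ 1 := by
    rw [hy, div_le_one hd]
    refine le_trans ?_ hnd
    gcongr
    nlinarith
  have hyn : n * √n * y = n ^ 2 * ε ^ 2 / d := by
    rw [hy]
    have : n * √n * (√n * ε ^ 2 / d) = n * √(n : ℝ) ^ 2 * ε ^ 2 / d := by ring
    rw [this, hsn2]; ring
  refine ⟨y ^ (-κ), Real.rpow_pos_of_pos hy0 _, ?_⟩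
  have t1 : 32 * (n * (B / √d) * (Real.exp ε - 1)) ^ 2 ≤
      32 * B ^ 2 * Real.exp Cε ^ 2 * (n ^ 2 * ε ^ 2 / d) := by
    have h1 : Real.exp ε - 1 ≤ ε * Real.exp Cε := by
      have h2 := abs_exp_sub_one_le_mul_exp ε
      rw [abs_of_pos hε] at h2
      refine (le_abs_self _).trans (h2.trans ?_)
      gcongr
    have h0 : 0 ≤ Real.exp ε - 1 := sub_nonneg.2 (Real.one_le_exp hε.le)
    calc 32 * (n * (B / √d) * (Real.exp ε - 1)) ^ 2
        ≤ 32 * (n * (B / √d) * (ε * Real.exp Cε)) ^ 2 := by gcongr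
      _ = 32 * B ^ 2 * Real.exp Cε ^ 2 * (n ^ 2 * ε ^ 2 / √d ^ 2) := by ring
      _ = _ := by rw [hsd2]
  have t2 : 8 * (n * (B / √d) * δ * ((B * √d) * √n * y ^ (-κ))) ≤
      8 * B ^ 2 * Cδ * G ^ (1 + κ) * (n ^ 2 * ε ^ 2 / d) := by
    have h1 : √n * ε ^ 2 * D₁⁻¹ ≤ G * y := by
      have h2 : D₁⁻¹ ≤ G / d := by
        rw [← one_div, div_le_div_iff₀ hD₁ hd]; linarith
      calc √n * ε ^ 2 * D₁⁻¹ ≤ √n * ε ^ 2 * (G / d) := by gcongr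
        _ = G * y := by rw [hy]; ring
    have h2 : δ * y ^ (-κ) ≤ Cδ * G ^ (1 + κ) * y := by
      have h3 : δ ≤ Cδ * (G * y) ^ (1 + κ) := hδC.trans (by gcongr)
      have h4 : y ^ (1 + κ) * y ^ (-κ) = y := by
        rw [← Real.rpow_add hy0]; simp
      calc δ * y ^ (-κ) ≤ Cδ * (G * y) ^ (1 + κ) * y ^ (-κ) := by gcongr
        _ = Cδ * G ^ (1 + κ) * (y ^ (1 + κ) * y ^ (-κ)) := by
          rw [Real.mul_rpow hG.le hy0.le]; ring
        _ = _ := by rw [h4]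
    calc 8 * (n * (B / √d) * δ * ((B * √d) * √n * y ^ (-κ)))
        = 8 * B ^ 2 * (n * √n) * (δ * y ^ (-κ)) := by field_simp
      _ ≤ 8 * B ^ 2 * (n * √n) * (Cδ * G ^ (1 + κ) * y) := by gcongr
      _ = 8 * B ^ 2 * Cδ * G ^ (1 + κ) * (n * √n * y) := by ring
      _ = _ := by rw [hyn]
  have t3 : c * (n * (B * √d) ^ 2) / (y ^ (-κ)) ^ (2 * s) ≤
      c * B ^ 2 * Cε ^ 2 * (n ^ 2 * ε ^ 2 / d) := by
    have h1 : ((y ^ (-κ)) ^ (2 * s))⁻¹ ≤ y ^ 3 := by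
      rw [← inv_pow, Real.rpow_neg hy0.le, inv_inv, ← Real.rpow_natCast, ← Real.rpow_mul hy0.le,
        ← Real.rpow_natCast]
      refine Real.rpow_le_rpow_of_exponent_ge hy0 hy1 ?_
      push_cast; linarith
    have h2 : d * y ^ 2 ≤ Cε ^ 2 * √n := by
      have h3 : d * y ^ 2 = y * (√n * ε ^ 2) := by rw [hy]; field_simp
      rw [h3]
      have h4 : ε ^ 2 ≤ Cε ^ 2 := by gcongr
      calc y * (√n * ε ^ 2) ≤ 1 * (√n * Cε ^ 2) := by gcongr
        _ = _ := by ring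
    calc c * (n * (B * √d) ^ 2) / (y ^ (-κ)) ^ (2 * s)
        = c * (n * (B ^ 2 * √d ^ 2)) * ((y ^ (-κ)) ^ (2 * s))⁻¹ := by
          rw [div_eq_mul_inv]; ring
      _ ≤ c * (n * (B ^ 2 * √d ^ 2)) * y ^ 3 := by gcongr
      _ = c * B ^ 2 * n * y * (d * y ^ 2) := by rw [hsd2]; ring
      _ ≤ c * B ^ 2 * n * y * (Cε ^ 2 * √n) := by gcongr
      _ = c * B ^ 2 * Cε ^ 2 * (n * √n * y) := by ring
      _ = _ := by rw [hyn]
  linarith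

/-- A step length for which all the linearizations of the likelihood ratios are valid. -/
lemma step_small {b η : ℝ} {n s : ℕ} (hb : 0 ≤ b) (hη : 0 < η)
    (h : η ≤ 1 / ((2 * s + 2) * (b + 1) * (n + 1))) :
    η * b ≤ 1 ∧ 2 * n * η ^ 2 ≤ 1 ∧ (2 * s + 2) * (η * b * √n) ≤ 1 := by
  rw [le_div_iff₀ (by positivity)] at h
  have hs : (0 : ℝ) ≤ s := s.cast_nonneg
  have hn : (0 : ℝ) ≤ n := n.cast_nonneg
  have hsn : √(n : ℝ) ≤ n + 1 := by
    rw [Real.sqrt_le_left (by positivity)]; nlinarith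
  have h1 : η * ((2 * s + 2) * b * (n + 1)) ≤ 1 := by
    refine le_trans ?_ h
    gcongr; linarith
  have h2 : η * (2 * (n + 1)) ≤ 1 := by
    refine le_trans ?_ h
    have : 2 * ((n : ℝ) + 1) ≤ (2 * s + 2) * (b + 1) * (n + 1) := by
      gcongr; nlinarith
    gcongr
  have hη1 : η ≤ 1 := by nlinarith
  refine ⟨?_, ?_, ?_⟩
  · refine le_trans ?_ h1
    gcongr
    have h3 : 1 ≤ (2 * (s : ℝ) + 2) * (n + 1) := by nlinarith
    nlinarith
  · nlinarith
  · calc (2 * s + 2) * (η * b * √n) = η * ((2 * s + 2) * b * √n) := by ring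
      _ ≤ η * ((2 * s + 2) * b * (n + 1)) := by gcongr
      _ ≤ 1 := h1

/-- The squared Hellinger distance of the transcript laws of one server, when one coefficient moves
by `T`: the information of `n` observations is `n`, and privacy reduces it to `n² ε² / d`. The
direction `ψ` is a unit vector localized to an interval of length of order `1 / d`, a fact used
through its sup norm and its `L₁` norm. -/
theorem exists_hellingerSqLE_server {B G Cε Cδ κ : ℝ} (hB : 0 < B) (hG : 0 < G) (hCδ : 0 < Cδ)
    (hκ : 0 < κ) : ∃ C : ℝ, 0 < C ∧ ∀ (d D₁ : ℝ), 0 < D₁ → 0 < d → d ≤ G * D₁ →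
      ∀ (n : ℕ) (ε δ : ℝ), 0 < ε → ε ≤ Cε → 0 ≤ δ →
        δ ≤ Cδ * ((n : ℝ) ^ (1 / 2 : ℝ) * ε ^ 2 * D₁⁻¹) ^ (1 + κ) →
      ∀ (𝒯 : Type w) [MeasurableSpace 𝒯] (K : Kernel (Fin n → Obs) 𝒯) [IsMarkovKernel K],
        IsDP ε δ K → ∀ (ψ : L2) (u : unitInterval → ℝ), Measurable u →
        (ψ : unitInterval → ℝ) =ᵐ[volume] u → (∀ x, |u x| ≤ B * √d) → ∫ x, |u x| ≤ B / √d →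
        ∫ x, u x ^ 2 ≤ 1 → ∀ (T : ℝ), 0 < T → ∀ f : L2,
        HellingerSqLE ((sampleLaw n f).bind K) ((sampleLaw n (f + T • ψ)).bind K)
          (C * min (n ^ 2 * ε ^ 2 / d) n * T ^ 2) := by
  -- the order `2 s + 2` of the moments is chosen such that `y ^ (2 κ s) ≤ y ^ 3` for `y ≤ 1`
  set s : ℕ := ⌈2 / κ⌉₊ with hs
  have hsκ : 3 ≤ κ * (2 * s) := by
    have h := Nat.le_ceil (2 / κ)
    rw [div_le_iff₀ hκ, ← hs] at h
    linarith
  set c : ℝ := 2 ^ (2 * s + 5) * Real.exp 3 * (2 * s + 2).factorial with hc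
  have hc0 : 0 < c := by positivity
  set C₁ : ℝ := 32 * B ^ 2 * Real.exp Cε ^ 2 + 8 * B ^ 2 * Cδ * G ^ (1 + κ) + c * B ^ 2 * Cε ^ 2
    with hC₁
  have hC₁0 : 0 ≤ C₁ := by positivity
  refine ⟨C₁ + 4, by linarith, ?_⟩
  intro d D₁ hD₁ hd hdG n ε δ hε hεC hδ hδC 𝒯 _ K _ hK ψ u hu hψ hub hu1 hu2 T hT f
  have hb0 : 0 < B * √d := mul_pos hB (Real.sqrt_pos.2 hd)
  have hη₀ : 0 < 1 / ((2 * s + 2) * (B * √d + 1) * ((n : ℝ) + 1)) := by positivity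
  rcases Nat.eq_zero_or_pos n with hn | hn
  · have := hellingerSqLE_of_step (K := K) (ψ := ψ) (r := 4 * n) hT hη₀ (fun f η h1 h2 => by
      obtain ⟨e1, e2, -⟩ := step_small hb0.le h1 h2
      exact discriminationLE_nonprivate hu hψ hub hu2 f h1 e1 e2) f
    refine this.mono ?_
    subst hn
    simp
  -- for `d ≤ n ε²` privacy does not reduce the information below `n`
  rcases le_total d (n * ε ^ 2) with hnd | hnd
  · have := hellingerSqLE_of_step (K := K) (ψ := ψ) (r := 4 * n) hT hη₀ (fun f η h1 h2 => by
      obtain ⟨e1, e2, -⟩ := step_small hb0.le h1 h2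
      exact discriminationLE_nonprivate hu hψ hub hu2 f h1 e1 e2) f
    refine this.mono ?_
    rw [min_eq_right]
    · gcongr; linarith
    · rw [le_div_iff₀ hd]
      calc n * d ≤ n * (n * ε ^ 2) := by gcongr
        _ = _ := by ring
  · obtain ⟨Λ, hΛ, hle⟩ := private_rate_le hB hG hCδ hκ hsκ hD₁ hd hdG hn hε hεC hδC hnd hc0
    have := hellingerSqLE_of_step (K := K) (ψ := ψ) hT hη₀ (fun f η h1 h2 => by
      obtain ⟨e1, e2, e3⟩ := step_small hb0.le h1 h2
      exact discriminationLE_private hε.le hδ hK hn hu hψ hb0 hub hu1 hu2 s hΛ f h1 e1 e2 e3) f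
    refine this.mono ?_
    rw [min_eq_left]
    · refine mul_le_mul_of_nonneg_right (hle.trans ?_) (sq_nonneg T)
      rw [← hC₁]
      gcongr; linarith
    · rw [div_le_iff₀ hd]
      calc (n : ℝ) ^ 2 * ε ^ 2 = n * (n * ε ^ 2) := by ring
        _ ≤ n * d := by gcongr

end Server

/-! ### Wavelets of one level -/

section Wavelets

lemma Generators.All.exists_dilate_eq {g : Generators} {Q : (ℝ → ℝ) → Prop} (hg : g.All Q)
    (l k : ℕ) : ∃ φ, Q φ ∧ ∃ a b : ℝ, |a| = 2 ^ l ∧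
      ∀ x, g.dilate l k x = (2 : ℝ) ^ ((l : ℝ) / 2) * φ (a * x + b) := by
  unfold Generators.dilate
  have h2 : |(2 : ℝ) ^ l| = 2 ^ l := abs_of_pos (by positivity)
  by_cases h : k < g.numLeft
  · exact ⟨_, hg.2.1 ⟨k, h⟩, 2 ^ l, 0, h2, fun x => by simp [h]⟩
  by_cases h' : 2 ^ l - 1 - k < g.numRight
  · refine ⟨_, hg.2.2 ⟨_, h'⟩, -2 ^ l, 2 ^ l, by rw [abs_neg, h2], fun x => ?_⟩
    rw [dif_neg h, dif_pos h']
    congr 2; ring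
  · refine ⟨_, hg.1, 2 ^ l, -k, h2, fun x => ?_⟩
    rw [dif_neg h, dif_neg h', sub_eq_add_neg]

/-- The generating functions are bounded in sup norm and in `L₁` norm, by a common constant. -/
lemma Generators.exists_bound {g : Generators} (hc : g.All Continuous)
    (hs : g.All HasCompactSupport) : ∃ B : ℝ, 0 < B ∧
      g.All fun φ => Continuous φ ∧ Integrable φ ∧ (∀ x, |φ x| ≤ B) ∧ ∫ x, |φ x| ≤ B := by
  have h1 : ∀ φ : ℝ → ℝ, Continuous φ → HasCompactSupport φ →
      ∃ B : ℝ, 0 ≤ B ∧ ∀ B', B ≤ B' →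
        (Continuous φ ∧ Integrable φ ∧ (∀ x, |φ x| ≤ B') ∧ ∫ x, |φ x| ≤ B') := by
    intro φ hφ hφs
    obtain ⟨C, hC⟩ := hφ.bounded_above_of_compact_support hφs
    refine ⟨max (max C 0) (∫ x, |φ x|), le_max_of_le_left (le_max_right _ _), fun B' hB' =>
      ⟨hφ, hφ.integrable_of_hasCompactSupport hφs, fun x => ?_, (le_max_right _ _).trans hB'⟩⟩
    exact (hC x).trans ((le_max_left _ _).trans ((le_max_left _ _).trans hB'))
  obtain ⟨Bi, hBi0, hBi⟩ := h1 _ hc.1 hs.1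
  choose Bl hBl0 hBl using fun i => h1 _ (hc.2.1 i) (hs.2.1 i)
  choose Br hBr0 hBr using fun i => h1 _ (hc.2.2 i) (hs.2.2 i)
  have hl := Finset.sum_nonneg fun i (_ : i ∈ Finset.univ) => hBl0 i
  have hr := Finset.sum_nonneg fun i (_ : i ∈ Finset.univ) => hBr0 i
  refine ⟨1 + Bi + ∑ i, Bl i + ∑ i, Br i, by linarith, hBi _ (by linarith), fun i => hBl i _ ?_,
    fun i => hBr i _ ?_⟩
  · have := Finset.single_le_sum (fun i _ => hBl0 i) (Finset.mem_univ i); linarith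
  · have := Finset.single_le_sum (fun i _ => hBr0 i) (Finset.mem_univ i); linarith

lemma integral_unitInterval_le {g : ℝ → ℝ} (hg : Integrable g) (h0 : ∀ x, 0 ≤ g x) :
    ∫ x : unitInterval, g x ≤ ∫ x, g x := by
  have : ∫ x : unitInterval, g x = ∫ x in Set.Icc (0 : ℝ) 1, g x :=
    integral_subtype measurableSet_Icc g
  rw [this]
  exact setIntegral_le_integral hg (Filter.Eventually.of_forall h0)

lemma two_rpow_half (l : ℕ) : (2 : ℝ) ^ ((l : ℝ) / 2) = √((2 : ℝ) ^ l) := by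
  rw [Real.sqrt_eq_rpow, ← Real.rpow_natCast, ← Real.rpow_mul zero_le_two]
  congr 1; ring

/-- A wavelet of level `l` is localized to an interval of length of order `2 ^ (-l)`: its sup norm
is of order `2 ^ (l / 2)` and its `L₁` norm of order `2 ^ (-l / 2)`. -/
lemma WaveletBasis.exists_localization {A : ℕ} (W : WaveletBasis A) : ∃ B : ℝ, 0 < B ∧
    ∀ (l k : ℕ), W.l₀ < l →
      Measurable (waveletFun W.father W.mother W.l₀ l k) ∧
      (∀ x, |waveletFun W.father W.mother W.l₀ l k x| ≤ B * √((2 : ℝ) ^ l)) ∧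
      ∫ x : unitInterval, |waveletFun W.father W.mother W.l₀ l k x| ≤ B / √((2 : ℝ) ^ l) := by
  have hcont : W.mother.All Continuous :=
    ⟨W.mother_smooth.1.continuous, fun i => (W.mother_smooth.2.1 i).continuous,
      fun i => (W.mother_smooth.2.2 i).continuous⟩
  obtain ⟨B, hB, hall⟩ := Generators.exists_bound hcont W.mother_support
  refine ⟨B, hB, fun l k hl => ?_⟩
  obtain ⟨φ, ⟨hφc, hφi, hφb, hφ1⟩, a, b, ha, heq⟩ := hall.exists_dilate_eq l k
  have hw : waveletFun W.father W.mother W.l₀ l k =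
      fun x => √((2 : ℝ) ^ l) * φ (a * x + b) := by
    funext x
    rw [waveletFun, if_neg hl.ne', heq, two_rpow_half]
  have h2l : (0 : ℝ) < 2 ^ l := by positivity
  have hs : 0 < √((2 : ℝ) ^ l) := Real.sqrt_pos.2 h2l
  have ha0 : a ≠ 0 := by rw [← abs_pos, ha]; exact h2l
  rw [hw]
  refine ⟨by fun_prop, fun x => ?_, ?_⟩
  · rw [abs_mul, abs_of_pos hs, mul_comm]
    gcongr
    exact hφb _
  · have hi : Integrable fun x : ℝ => |√((2 : ℝ) ^ l) * φ (a * x + b)| :=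
      (((hφi.comp_add_right b).comp_mul_left' ha0).const_mul _).abs
    refine (integral_unitInterval_le hi fun x => abs_nonneg _).trans ?_
    simp_rw [abs_mul, abs_of_pos hs]
    rw [integral_const_mul, Measure.integral_comp_mul_left (fun y => |φ (y + b)|) a,
      integral_add_right_eq_self (fun y => |φ y|), abs_inv, ha, smul_eq_mul, le_div_iff₀ hs]
    have h3 : √((2 : ℝ) ^ l) * √((2 : ℝ) ^ l) = 2 ^ l := Real.mul_self_sqrt h2l.le
    calc √((2 : ℝ) ^ l) * (((2 : ℝ) ^ l)⁻¹ * ∫ x, |φ x|) * √((2 : ℝ) ^ l)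
        = (√((2 : ℝ) ^ l) * √((2 : ℝ) ^ l)) * ((2 : ℝ) ^ l)⁻¹ * ∫ x, |φ x| := by ring
      _ = ∫ x, |φ x| := by rw [h3, mul_inv_cancel₀ h2l.ne', one_mul]
      _ ≤ B := hφ1

lemma WaveletBasis.integral_waveletFun_sq {A : ℕ} (W : WaveletBasis A) (l : ℕ)
    (k : Fin (levelSize W.l₀ l)) :
    ∫ x : unitInterval, waveletFun W.father W.mother W.l₀ l k x ^ 2 = 1 := by
  have h1 : inner ℝ (W.basis ⟨l, k⟩) (W.basis ⟨l, k⟩) = (1 : ℝ) := by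
    rw [real_inner_self_eq_norm_sq, W.basis.orthonormal.1, one_pow]
  rw [L2.inner_def] at h1
  rw [← h1]
  refine integral_congr_ae ?_
  filter_upwards [W.basis_ae l k] with x hx
  rw [hx, real_inner_self_eq_norm_sq, Real.norm_eq_abs, sq_abs]

/-! ### Besov norms of functions of one level -/

lemma lqNorm_zero {ι : Type*} {q : ℝ≥0∞} (hq : 0 < q) : lqNorm q (fun _ : ι => 0) = 0 := by
  unfold lqNorm
  split_ifs with h
  · simp
  · have : 0 < q.toReal := ENNReal.toReal_pos hq.ne' h
    simp [ENNReal.zero_rpow_of_pos this, ENNReal.zero_rpow_of_pos (inv_pos.2 this)]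

lemma lqNorm_eq_single {ι : Type*} {q : ℝ≥0∞} (hq : 0 < q) {a : ι → ℝ≥0∞} (i : ι)
    (h : ∀ j ≠ i, a j = 0) : lqNorm q a = a i := by
  unfold lqNorm
  split_ifs with hq'
  · refine le_antisymm (iSup_le fun j => ?_) (le_iSup a i)
    rcases eq_or_ne j i with rfl | hj
    · exact le_rfl
    · simp [h j hj]
  · have h0 : 0 < q.toReal := ENNReal.toReal_pos hq.ne' hq'
    rw [tsum_eq_single i fun j hj => by rw [h j hj, ENNReal.zero_rpow_of_pos h0],
      ← ENNReal.rpow_mul, mul_one_div_cancel h0.ne', ENNReal.rpow_one]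

lemma lqNorm_fin_le {d : ℕ} {p : ℝ≥0∞} (hp : 0 < p) {a : Fin d → ℝ≥0∞} {b : ℝ≥0∞}
    (h : ∀ k, a k ≤ b) : lqNorm p a ≤ (d : ℝ≥0∞) ^ (p⁻¹).toReal * b := by
  unfold lqNorm
  split_ifs with hp'
  · subst hp'
    simpa using h
  · have h0 : 0 < p.toReal := ENNReal.toReal_pos hp.ne' hp'
    rw [tsum_fintype, ENNReal.toReal_inv, ← one_div]
    have h1 : ∑ k, a k ^ p.toReal ≤ (d : ℝ≥0∞) * b ^ p.toReal := by
      refine (Finset.sum_le_sum fun k _ => ENNReal.rpow_le_rpow (h k) h0.le).trans (le_of_eq ?_)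
      simp
    refine (ENNReal.rpow_le_rpow h1 (by positivity)).trans (le_of_eq ?_)
    rw [ENNReal.mul_rpow_of_nonneg _ _ (by positivity), ← ENNReal.rpow_mul,
      mul_one_div_cancel h0.ne', ENNReal.rpow_one]

/-- The function of level `L` with wavelet coefficients `c`. -/
def WaveletBasis.levelSum {A : ℕ} (W : WaveletBasis A) (L : ℕ)
    (c : Fin (levelSize W.l₀ L) → ℝ) : L2 :=
  ∑ k, c k • W.basis ⟨L, k⟩

lemma WaveletBasis.coeff_levelSum_self {A : ℕ} (W : WaveletBasis A) (L : ℕ)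
    (c : Fin (levelSize W.l₀ L) → ℝ) (k : Fin (levelSize W.l₀ L)) :
    W.coeff (W.levelSum L c) L k = c k := by
  have ho := W.basis.orthonormal
  rw [orthonormal_iff_ite] at ho
  simp only [coeff, levelSum, inner_sum, inner_smul_right, ho]
  rw [Finset.sum_eq_single k]
  · simp
  · intro j _ hj
    simp [Ne.symm hj]
  · simp

lemma WaveletBasis.coeff_levelSum_of_ne {A : ℕ} (W : WaveletBasis A) {L l : ℕ} (hl : l ≠ L)
    (c : Fin (levelSize W.l₀ L) → ℝ) (k : Fin (levelSize W.l₀ l)) :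
    W.coeff (W.levelSum L c) l k = 0 := by
  have ho := W.basis.orthonormal
  rw [orthonormal_iff_ite] at ho
  simp only [coeff, levelSum, inner_sum, inner_smul_right, ho]
  refine Finset.sum_eq_zero fun j _ => ?_
  rw [if_neg fun e => hl (congrArg Sigma.fst e), mul_zero]

lemma levelSize_of_lt {l₀ l : ℕ} (h : l₀ < l) : levelSize l₀ l = 2 ^ l := by
  rw [levelSize, if_neg h.not_gt, if_neg h.ne']

lemma WaveletBasis.levelSum_mem_besovBall {A : ℕ} (W : WaveletBasis A) {α R h : ℝ} {p q : ℝ≥0∞}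
    (hp : 0 < p) (hq : 0 < q) {L : ℕ} (hL : W.l₀ < L)
    (hR : ((2 : ℝ) ^ L) ^ (α + 1 / 2) * h ≤ R) {c : Fin (levelSize W.l₀ L) → ℝ}
    (hc : ∀ k, |c k| ≤ h) : W.levelSum L c ∈ W.besovBall α p q R := by
  show W.besovNorm α p q _ ≤ _
  rw [besovNorm, lqNorm_eq_single hq L]
  · simp only [coeff_levelSum_self]
    have h1 : lqNorm p (fun k => ‖c k‖ₑ) ≤
        ((levelSize W.l₀ L : ℕ) : ℝ≥0∞) ^ (p⁻¹).toReal * ENNReal.ofReal h :=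
      lqNorm_fin_le hp fun k => by
        rw [Real.enorm_eq_ofReal_abs]; exact ENNReal.ofReal_le_ofReal (hc k)
    refine (mul_le_mul_right h1 _).trans ?_
    have h2 : ((levelSize W.l₀ L : ℕ) : ℝ≥0∞) ^ (p⁻¹).toReal =
        ENNReal.ofReal ((2 : ℝ) ^ ((L : ℝ) * (p⁻¹).toReal)) := by
      rw [levelSize_of_lt hL, Real.rpow_mul zero_le_two, Real.rpow_natCast,
        ← ENNReal.ofReal_rpow_of_pos (by positivity), ENNReal.ofReal_pow zero_le_two]
      simp
    rw [h2, ← ENNReal.ofReal_mul (by positivity), ← ENNReal.ofReal_mul (by positivity)]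
    refine ENNReal.ofReal_le_ofReal (le_trans (le_of_eq ?_) hR)
    rw [← mul_assoc, ← Real.rpow_add two_pos, ← Real.rpow_natCast, ← Real.rpow_mul zero_le_two]
    congr 2; ring
  · intro l hl
    simp only [W.coeff_levelSum_of_ne hl, enorm_zero, lqNorm_zero hp, mul_zero]

end Wavelets

/-! ### Assouad's lemma over the wavelets of one level -/

section Assouad

universe u

variable {m : ℕ} {n : Fin m → ℕ} {ε δ : Fin m → ℝ}

instance (P : Protocol.{u} n ε δ) (f : L2) : IsProbabilityMeasure (P.transcriptLaw f) := by
  unfold Protocol.transcriptLaw; infer_instance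

variable {A : ℕ} (W : WaveletBasis A) (L : ℕ)

/-- The vertex `∑ ± h ψ_{Lk}` of the hypercube with signs `θ`. -/
def WaveletBasis.vertex (h : ℝ) (θ : Fin (levelSize W.l₀ L) → Bool) : L2 :=
  W.levelSum L fun k => if θ k then h else -h

variable {W L}

lemma WaveletBasis.vertex_update_true (h : ℝ) (θ : Fin (levelSize W.l₀ L) → Bool)
    (k : Fin (levelSize W.l₀ L)) :
    W.vertex L h (Function.update θ k true) =
      W.vertex L h (Function.update θ k false) + (2 * h) • W.basis ⟨L, k⟩ := by
  rw [← sub_eq_iff_eq_add', vertex, vertex, levelSum, levelSum, ← Finset.sum_sub_distrib,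
    Finset.sum_eq_single k]
  · rw [← sub_smul]; simp; ring_nf
  · intro j _ hj
    simp [Function.update_of_ne hj]
  · simp

/-- The risk of estimating the `k`-th coefficient at the vertex `θ`. -/
def coordRisk (P : Protocol.{u} n ε δ) (W : WaveletBasis A) (L : ℕ) (h : ℝ)
    (k : Fin (levelSize W.l₀ L)) (θ : Fin (levelSize W.l₀ L) → Bool) : ℝ≥0∞ :=
  ∫⁻ t, ENNReal.ofReal ((inner ℝ (W.basis ⟨L, k⟩) (P.estimator t) - if θ k then h else -h) ^ 2)
    ∂(P.transcriptLaw (W.vertex L h θ))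

lemma measurable_inner_estimator (P : Protocol.{u} n ε δ) (ψ : L2) :
    Measurable fun t => inner ℝ ψ (P.estimator t) :=
  (((innerSL ℝ ψ).continuous.comp_stronglyMeasurable P.estimator_meas)).measurable

/-- Bessel's inequality: the risk is at least the sum of the risks of the coefficients of one
level. -/
lemma sum_coordRisk_le_risk (P : Protocol.{u} n ε δ) (h : ℝ)
    (θ : Fin (levelSize W.l₀ L) → Bool) :
    ∑ k, coordRisk P W L h k θ ≤ P.risk (W.vertex L h θ) := by
  simp only [coordRisk, Protocol.risk]
  rw [← lintegral_finsetSum _ fun k _ =>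
    (((measurable_inner_estimator P _).sub_const _).pow_const 2).ennreal_ofReal]
  refine lintegral_mono fun t => ?_
  rw [← ENNReal.ofReal_sum_of_nonneg fun k _ => sq_nonneg _, ← ofReal_norm, ← ENNReal.ofReal_pow
    (norm_nonneg _)]
  refine ENNReal.ofReal_le_ofReal ?_
  have hon : Orthonormal ℝ fun k : Fin (levelSize W.l₀ L) => W.basis ⟨L, k⟩ :=
    W.basis.orthonormal.comp _ fun i j hij => by simpa using hij
  refine le_trans (le_of_eq ?_) (hon.sum_inner_products_le (P.estimator t - W.vertex L h θ)
    (s := Finset.univ))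
  refine Finset.sum_congr rfl fun k _ => ?_
  rw [Real.norm_eq_abs, sq_abs, inner_sub_right]
  congr 2
  exact (W.coeff_levelSum_self L (fun k => if θ k then h else -h) k).symm

/-- Two vertices that differ in the `k`-th sign only: the two-point bound for the `k`-th
coefficient. -/
lemma le_coordRisk_add {P : Protocol.{u} n ε δ} {h : ℝ} {k : Fin (levelSize W.l₀ L)}
    (H : ∀ f : L2, HellingerSqLE (P.transcriptLaw f)
      (P.transcriptLaw (f + (2 * h) • W.basis ⟨L, k⟩)) (1 / 2))
    (θ : Fin (levelSize W.l₀ L) → Bool) :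
    ENNReal.ofReal (h ^ 2 / 2) ≤
      coordRisk P W L h k θ + coordRisk P W L h k (Function.update θ k (!θ k)) := by
  have h1 := H (W.vertex L h (Function.update θ k false))
  rw [← WaveletBasis.vertex_update_true] at h1
  have h2 := h1.two_point (measurable_inner_estimator P (W.basis ⟨L, k⟩)) (-h)
  have h3 : coordRisk P W L h k (Function.update θ k false) +
      coordRisk P W L h k (Function.update θ k true) =
      coordRisk P W L h k θ + coordRisk P W L h k (Function.update θ k (!θ k)) := by
    rcases hθ : θ k with - | -
    · have : Function.update θ k false = θ := by rw [← hθ, Function.update_eq_self]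
      rw [this]; rfl
    · have : Function.update θ k true = θ := by rw [← hθ, Function.update_eq_self]
      rw [this, add_comm]; rfl
  rw [← h3]
  refine le_trans (ENNReal.ofReal_le_ofReal ?_) (h2.trans (le_of_eq ?_))
  · nlinarith [sq_nonneg h]
  · simp [coordRisk, sub_eq_add_neg]

/-- If every coefficient of level `L` can move by `2 h` at bounded Hellinger distance of the laws of
the transcripts, then estimating all of them costs at least `h² / 4` for each. -/
lemma Protocol.le_iSup_risk (P : Protocol.{u} n ε δ) {h : ℝ} {F : Set L2}
    (H : ∀ (k : Fin (levelSize W.l₀ L)) (f : L2), HellingerSqLE (P.transcriptLaw f)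
      (P.transcriptLaw (f + (2 * h) • W.basis ⟨L, k⟩)) (1 / 2))
    (hF : ∀ θ, W.vertex L h θ ∈ F) :
    ENNReal.ofReal (levelSize W.l₀ L * (h ^ 2 / 4)) ≤ ⨆ f ∈ F, P.risk f := by
  set S := ⨆ f ∈ F, P.risk f with hS
  have h1 : ∀ θ, ∑ k, coordRisk P W L h k θ ≤ S := fun θ =>
    (sum_coordRisk_le_risk P h θ).trans (le_iSup₂ (f := fun f _ => P.risk f) _ (hF θ))
  -- the flip of the `k`-th sign is a permutation of the vertices
  have hflip : ∀ k, ∑ θ, coordRisk P W L h k (Function.update θ k (!θ k)) =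
      ∑ θ, coordRisk P W L h k θ := fun k => by
    have hinv : Function.Involutive fun θ : Fin (levelSize W.l₀ L) → Bool =>
        Function.update θ k (!θ k) := fun θ => by simp
    exact (Equiv.sum_comp hinv.toPerm fun θ => coordRisk P W L h k θ)
  set V : ℝ≥0∞ := (Fintype.card (Fin (levelSize W.l₀ L) → Bool) : ℝ≥0∞) with hV
  have hV0 : V ≠ 0 := by simp [hV]
  have hVt : V ≠ ∞ := by simp [hV]
  have h2 : V * (levelSize W.l₀ L * ENNReal.ofReal (h ^ 2 / 2)) ≤ V * (2 * S) := by
    calc V * (levelSize W.l₀ L * ENNReal.ofReal (h ^ 2 / 2))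
        = ∑ k : Fin (levelSize W.l₀ L), ∑ θ : Fin (levelSize W.l₀ L) → Bool,
            ENNReal.ofReal (h ^ 2 / 2) := by
          rw [Finset.sum_const, Finset.sum_const, Finset.card_univ, Finset.card_univ,
            Fintype.card_fin, nsmul_eq_mul, nsmul_eq_mul, ← hV]
          ring
      _ ≤ ∑ k, ∑ θ, (coordRisk P W L h k θ +
            coordRisk P W L h k (Function.update θ k (!θ k))) :=
          Finset.sum_le_sum fun k _ => Finset.sum_le_sum fun θ _ => le_coordRisk_add (H k) θ
      _ = 2 * ∑ θ, ∑ k, coordRisk P W L h k θ := by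
          simp_rw [Finset.sum_add_distrib, hflip]
          rw [two_mul, Finset.sum_comm]
      _ ≤ 2 * ∑ θ : Fin (levelSize W.l₀ L) → Bool, S := by
          gcongr with θ; exact h1 θ
      _ = V * (2 * S) := by
          rw [Finset.sum_const, Finset.card_univ, nsmul_eq_mul, ← hV]; ring
  rw [ENNReal.mul_le_mul_iff_right hV0 hVt] at h2
  have h3 : (levelSize W.l₀ L : ℝ≥0∞) * ENNReal.ofReal (h ^ 2 / 2) =
      2 * ENNReal.ofReal (levelSize W.l₀ L * (h ^ 2 / 4)) := by
    rw [← ENNReal.ofReal_natCast (levelSize W.l₀ L),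
      ← ENNReal.ofReal_mul (Nat.cast_nonneg _), ← ENNReal.ofReal_ofNat 2,
      ← ENNReal.ofReal_mul zero_le_two]
    congr 1; ring
  rw [h3] at h2
  exact (ENNReal.mul_le_mul_iff_right two_ne_zero (by simp)).1 h2

end Assouad

/-! ### The resolution level and the budget of all servers -/

section Budget

lemma exists_level {D₁ : ℝ} (hD : 1 ≤ D₁) (l₀ : ℕ) :
    ∃ L : ℕ, l₀ < L ∧ D₁ ≤ (2 : ℝ) ^ L ∧ (2 : ℝ) ^ L ≤ 2 ^ (l₀ + 1) * D₁ := by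
  obtain ⟨k, h1, h2⟩ := exists_nat_pow_near hD one_lt_two
  refine ⟨k + (l₀ + 1), by omega, ?_, ?_⟩
  · refine h2.le.trans (pow_le_pow_right₀ one_le_two (by omega))
  · rw [pow_add, mul_comm]; gcongr

/-- When `D < 1` no server with data is limited by its sample size: `n D ≤ D ^ (2 α + 2) < D` is
impossible. So `D` may be replaced by `max D 1`. -/
lemma sum_min_le_max_rpow {m : ℕ} {n : Fin m → ℕ} {ε : Fin m → ℝ} {α D : ℝ} (hα : 0 < α)
    (hD : 0 < D)
    (hsum : D ^ (2 * α + 2) = ∑ j, min ((n j : ℝ) ^ 2 * ε j ^ 2) ((n j : ℝ) * D)) :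
    ∑ j, min ((n j : ℝ) ^ 2 * ε j ^ 2) (n j * max D 1) ≤ max D 1 ^ (2 * α + 2) := by
  rcases le_total 1 D with h1 | h1
  · rw [max_eq_left h1, ← hsum]
  rcases h1.eq_or_lt with rfl | h1
  · rw [max_self, hsum]
  rw [max_eq_right h1.le, Real.one_rpow]
  have hlt : D ^ (2 * α + 2) < D := by
    conv_rhs => rw [← Real.rpow_one D]
    exact Real.rpow_lt_rpow_of_exponent_gt hD h1 (by linarith)
  refine le_trans ?_ (hlt.le.trans h1.le)
  rw [hsum]
  refine Finset.sum_le_sum fun j _ => ?_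
  refine le_min (min_le_left _ _) ?_
  rcases Nat.eq_zero_or_pos (n j) with hn | hn
  · simp [hn]
  have hn1 : (1 : ℝ) ≤ n j := by exact_mod_cast hn
  by_contra hcon
  have h2 : (n j : ℝ) * D < (n j : ℝ) ^ 2 * ε j ^ 2 := (not_le.1 hcon).trans_le (min_le_left _ _)
  have h3 : min ((n j : ℝ) ^ 2 * ε j ^ 2) ((n j : ℝ) * D) ≤ D ^ (2 * α + 2) := by
    rw [hsum]
    exact Finset.single_le_sum (f := fun j => min ((n j : ℝ) ^ 2 * ε j ^ 2) ((n j : ℝ) * D))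
      (fun i _ => le_min (by positivity) (by positivity)) (Finset.mem_univ j)
  rw [min_eq_right h2.le] at h3
  nlinarith

lemma IsDP.mono {n : ℕ} {𝒯 : Type*} [MeasurableSpace 𝒯] {ε ε' δ : ℝ}
    {K : Kernel (Fin n → Obs) 𝒯} (hK : IsDP ε δ K) (h : ε ≤ ε') : IsDP ε' δ K := by
  intro z z' hz B hB
  refine (hK z z' hz B hB).trans ?_
  gcongr

/-- The privacy budgets may be assumed positive: a small increase of all of them at most doubles the
bound `S`. -/
lemma exists_pos_budget {m : ℕ} (n : Fin m → ℕ) (ε : Fin m → ℝ) {D₁ S : ℝ}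
    (hS : 1 ≤ S) (hsum : ∑ j, min ((n j : ℝ) ^ 2 * ε j ^ 2) (n j * D₁) ≤ S) :
    ∃ ε' : Fin m → ℝ, (∀ j, 0 < ε' j) ∧ (∀ j, ε j ≤ ε' j) ∧ (∀ j, ε' j ≤ max (ε j) 1) ∧
      ∑ j, min ((n j : ℝ) ^ 2 * ε' j ^ 2) (n j * D₁) ≤ 2 * S := by
  set N : ℝ := ∑ j, (n j : ℝ) ^ 2 with hN
  have hN0 : 0 ≤ N := Finset.sum_nonneg fun j _ => sq_nonneg _
  set e : ℝ := 1 / (1 + N) with he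
  have he0 : 0 < e := by positivity
  have he1 : e ≤ 1 := by rw [he, div_le_one (by positivity)]; linarith
  have heN : N * e ^ 2 ≤ 1 := by
    have : e * (1 + N) = 1 := by rw [he]; field_simp
    nlinarith
  refine ⟨fun j => max (ε j) e, fun j => lt_max_of_lt_right he0, fun j => le_max_left _ _,
    fun j => max_le_max le_rfl he1, ?_⟩
  calc ∑ j, min ((n j : ℝ) ^ 2 * max (ε j) e ^ 2) (n j * D₁)
      ≤ ∑ j, (min ((n j : ℝ) ^ 2 * ε j ^ 2) (n j * D₁) + (n j : ℝ) ^ 2 * e ^ 2) := by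
        refine Finset.sum_le_sum fun j _ => ?_
        have h1 : max (ε j) e ^ 2 ≤ ε j ^ 2 + e ^ 2 := by
          rcases le_total (ε j) e with h | h
          · rw [max_eq_right h]; nlinarith [sq_nonneg (ε j)]
          · rw [max_eq_left h]; nlinarith [sq_nonneg e]
        rw [← min_add_add_right]
        refine min_le_min ?_ (le_add_of_nonneg_right (by positivity))
        rw [← mul_add]; gcongr
    _ = ∑ j, min ((n j : ℝ) ^ 2 * ε j ^ 2) (n j * D₁) + N * e ^ 2 := by
        rw [Finset.sum_add_distrib, ← Finset.sum_mul]
    _ ≤ 2 * S := by linarith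

end Budget

/-! ### The lower bound -/

section LowerBound

universe u

/-- The worst-case risk of each protocol. The perturbation has size `h = ρ 2 ^ (-L (α + 1 / 2))`
at each wavelet of the level `L` with `2 ^ L` of order `max D 1`; the constant `ρ` is so small that
the perturbations lie in the Besov ball and that flipping one sign changes the law of all the
transcripts by a squared Hellinger distance of at most `1 / 2`. -/
theorem WaveletBasis.exists_le_iSup_risk {A : ℕ} (W : WaveletBasis A) {α : ℝ} {p q : ℝ≥0∞}
    {R Cε Cδ κ : ℝ} (hα : 0 < α) (hp : 0 < p) (hq : 0 < q) (hR : 0 < R) (hCδ : 0 < Cδ)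
    (hκ : 0 < κ) : ∃ c : ℝ, 0 < c ∧
      ∀ (m : ℕ) (n : Fin m → ℕ) (ε δ : Fin m → ℝ) (D : ℝ), (∀ j, 0 ≤ ε j ∧ ε j ≤ Cε) →
        (∀ j, 0 ≤ δ j) → 0 < D →
        D ^ (2 * α + 2) = ∑ j, min ((n j : ℝ) ^ 2 * ε j ^ 2) ((n j : ℝ) * D) →
        (∀ j, δ j ≤ Cδ * ((n j : ℝ) ^ (1 / 2 : ℝ) * ε j ^ 2 * (max D 1)⁻¹) ^ (1 + κ)) →
        ∀ P : Protocol.{u} n ε δ,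
          ENNReal.ofReal (c * min (D ^ (-(2 * α))) 1) ≤ ⨆ f ∈ W.besovBall α p q R, P.risk f := by
  obtain ⟨B, hB, hloc⟩ := W.exists_localization
  set G : ℝ := 2 ^ (W.l₀ + 1) with hG
  have hG0 : 0 < G := by positivity
  have hG1 : 1 ≤ G := one_le_pow₀ one_le_two
  obtain ⟨C, hC, hserver⟩ := exists_hellingerSqLE_server.{u} (B := B) (G := G) (Cε := max Cε 1)
    (Cδ := Cδ) (κ := κ) hB hG0 hCδ hκ
  set ρ : ℝ := min R (1 / √(16 * C * G)) with hρ
  have hCG : 0 < 16 * C * G := by positivity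
  have hρ0 : 0 < ρ := lt_min hR (by positivity)
  have hρ2 : ρ ^ 2 * (16 * C * G) ≤ 1 := by
    have h1 : ρ * √(16 * C * G) ≤ 1 := by
      rw [← le_div_iff₀ (Real.sqrt_pos.2 hCG)]; exact min_le_right _ _
    have h2 : ρ ^ 2 * (16 * C * G) = (ρ * √(16 * C * G)) ^ 2 := by
      rw [mul_pow, Real.sq_sqrt hCG.le]
    rw [h2]
    exact pow_le_one₀ (by positivity) h1
  refine ⟨ρ ^ 2 / 4 * G ^ (-(2 * α)), by positivity, ?_⟩
  intro m n ε δ D hε hδ hD hsum hδC P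
  set D₁ : ℝ := max D 1 with hD₁
  have hD1 : 1 ≤ D₁ := le_max_right _ _
  have hD10 : 0 < D₁ := by linarith
  obtain ⟨L, hL, hDL, hLD⟩ := exists_level hD1 W.l₀
  rw [← hG] at hLD
  set d : ℝ := (2 : ℝ) ^ L with hd
  have hd0 : 0 < d := by positivity
  have hS1 : 1 ≤ D₁ ^ (2 * α + 2) := Real.one_le_rpow hD1 (by linarith)
  obtain ⟨ε', hε'0, hεε', hε'1, hsum'⟩ :=
    exists_pos_budget n ε hS1 (sum_min_le_max_rpow hα hD hsum)
  set h : ℝ := ρ * d ^ (-(α + 1 / 2)) with hh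
  have hh0 : 0 < h := by positivity
  have hh2 : h ^ 2 = ρ ^ 2 * d ^ (-(2 * α + 1)) := by
    rw [hh, mul_pow, ← Real.rpow_natCast (d ^ _), ← Real.rpow_mul hd0.le]
    congr 2; push_cast; ring
  have hhell : ∀ (k : Fin (levelSize W.l₀ L)) (f : L2), HellingerSqLE (P.transcriptLaw f)
      (P.transcriptLaw (f + (2 * h) • W.basis ⟨L, k⟩)) (1 / 2) := by
    intro k f
    obtain ⟨hm, hb, h1⟩ := hloc L k hL
    have hj : ∀ j, HellingerSqLE ((sampleLaw (n j) f).bind (P.channel j))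
        ((sampleLaw (n j) (f + (2 * h) • W.basis ⟨L, k⟩)).bind (P.channel j))
        (C * min ((n j : ℝ) ^ 2 * ε' j ^ 2 / d) (n j) * (2 * h) ^ 2) := fun j => by
      refine hserver d D₁ hD10 hd0 hLD (n j) (ε' j) (δ j) (hε'0 j)
        ((hε'1 j).trans (max_le_max (hε j).2 le_rfl)) (hδ j) ((hδC j).trans ?_) (P.Transcript j)
        (P.channel j) ((P.isDP j).mono (hεε' j)) (W.basis ⟨L, k⟩)
        (fun x : unitInterval => waveletFun W.father W.mother W.l₀ L k x)
        (hm.comp measurable_subtype_coe) (W.basis_ae L k) (fun x => hb x) h1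
        (W.integral_waveletFun_sq L k).le (2 * h) (by positivity) f
      have := (hε j).1
      have := hεε' j
      gcongr
    refine (HellingerSqLE.pi hj).mono ?_
    have hmin : ∀ j, min ((n j : ℝ) ^ 2 * ε' j ^ 2 / d) (n j) ≤
        G / d * min ((n j : ℝ) ^ 2 * ε' j ^ 2) (n j * D₁) := fun j => by
      rw [mul_min_of_nonneg _ _ (by positivity)]
      refine min_le_min ?_ ?_
      · rw [div_mul_eq_mul_div]
        exact div_le_div_of_nonneg_right (le_mul_of_one_le_left (by positivity) hG1) hd0.le
      · rw [div_mul_eq_mul_div, le_div_iff₀ hd0]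
        calc (n j : ℝ) * d ≤ n j * (G * D₁) := by gcongr
          _ = _ := by ring
    have hDd : D₁ ^ (2 * α + 2) ≤ d ^ (2 * α + 2) :=
      Real.rpow_le_rpow hD10.le hDL (by linarith)
    have hdd : d ^ (-(2 * α + 1)) * d ^ (2 * α + 2) = d := by
      rw [← Real.rpow_add hd0]; ring_nf; exact Real.rpow_one d
    calc ∑ j, C * min ((n j : ℝ) ^ 2 * ε' j ^ 2 / d) (n j) * (2 * h) ^ 2
        ≤ ∑ j, C * (G / d * min ((n j : ℝ) ^ 2 * ε' j ^ 2) (n j * D₁)) * (2 * h) ^ 2 := by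
          gcongr with j; exact hmin j
      _ = 4 * C * G * h ^ 2 / d * ∑ j, min ((n j : ℝ) ^ 2 * ε' j ^ 2) (n j * D₁) := by
          rw [Finset.mul_sum]
          refine Finset.sum_congr rfl fun j _ => ?_
          ring
      _ ≤ 4 * C * G * h ^ 2 / d * (2 * d ^ (2 * α + 2)) := by
          gcongr
          exact hsum'.trans (by gcongr)
      _ = 8 * C * G * ρ ^ 2 * (d ^ (-(2 * α + 1)) * d ^ (2 * α + 2)) / d := by rw [hh2]; ring
      _ = 8 * C * G * ρ ^ 2 := by rw [hdd]; field_simp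
      _ ≤ 1 / 2 := by linarith
  have hball : ∀ θ, W.vertex L h θ ∈ W.besovBall α p q R := fun θ => by
    refine W.levelSum_mem_besovBall hp hq hL (h := h) ?_ fun k => ?_
    · rw [← hd, hh, mul_left_comm, ← Real.rpow_add hd0, add_neg_cancel, Real.rpow_zero, mul_one]
      exact min_le_left _ _
    · split_ifs
      · rw [abs_of_pos hh0]
      · rw [abs_neg, abs_of_pos hh0]
  refine le_trans (ENNReal.ofReal_le_ofReal ?_) (P.le_iSup_risk hhell hball)
  have hcast : ((levelSize W.l₀ L : ℕ) : ℝ) = d := by rw [levelSize_of_lt hL, hd]; push_cast; rfl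
  have hmin : min (D ^ (-(2 * α))) 1 ≤ D₁ ^ (-(2 * α)) := by
    rw [hD₁]
    rcases le_total D 1 with h1 | h1
    · rw [max_eq_right h1, Real.one_rpow]; exact min_le_right _ _
    · rw [max_eq_left h1]; exact min_le_left _ _
  have hdD : G ^ (-(2 * α)) * D₁ ^ (-(2 * α)) ≤ d ^ (-(2 * α)) := by
    rw [← Real.mul_rpow hG0.le hD10.le]
    exact Real.rpow_le_rpow_of_nonpos hd0 hLD (by linarith)
  have hdd : d * d ^ (-(2 * α + 1)) = d ^ (-(2 * α)) := by
    nth_rewrite 1 [← Real.rpow_one d]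
    rw [← Real.rpow_add hd0]; ring_nf
  calc ρ ^ 2 / 4 * G ^ (-(2 * α)) * min (D ^ (-(2 * α))) 1
      ≤ ρ ^ 2 / 4 * G ^ (-(2 * α)) * D₁ ^ (-(2 * α)) := by gcongr
    _ = ρ ^ 2 / 4 * (G ^ (-(2 * α)) * D₁ ^ (-(2 * α))) := by ring
    _ ≤ ρ ^ 2 / 4 * d ^ (-(2 * α)) := by gcongr
    _ = ρ ^ 2 / 4 * (d * d ^ (-(2 * α + 1))) := by rw [hdd]
    _ = levelSize W.l₀ L * (h ^ 2 / 4) := by rw [hcast, hh2]; ring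

end LowerBound

end FederatedDP

end

theorem mainTheorem4 {A : ℕ} (W : FederatedDP.WaveletBasis A) (α : ℝ) (p q : ENNReal)
    (R Cε Cδ κ : ℝ) (hA : α < A) (hp : 2 ≤ p) (hq : 1 ≤ q) (hα : 1 / 2 < α - (p⁻¹).toReal)
    (hR : 0 < R) (hCε : 0 < Cε) (hCδ : 0 < Cδ) (hκ : 0 < κ) :
    ∃ c : ℝ, 0 < c ∧
      ∀ (m : ℕ) (n : Fin m → ℕ) (ε δ : Fin m → ℝ) (D : ℝ),
        (∀ j, 0 ≤ ε j ∧ ε j ≤ Cε) →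
        (∀ j, 0 ≤ δ j) →
        0 < D →
        D ^ (2 * α + 2) = ∑ j, min ((n j : ℝ) ^ 2 * ε j ^ 2) ((n j : ℝ) * D) →
        (∀ j, δ j ≤ Cδ * ((n j : ℝ) ^ (1 / 2 : ℝ) * ε j ^ 2 * (max D 1)⁻¹) ^ (1 + κ)) →
        ENNReal.ofReal (c * min (D ^ (-(2 * α))) 1) ≤
          FederatedDP.globalMinimaxRisk n ε δ (W.besovBall α p q R) := by
  obtain ⟨c, hc, h⟩ := W.exists_le_iSup_risk (α := α) (p := p) (q := q) (Cε := Cε)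
    (by have := ENNReal.toReal_nonneg (a := p⁻¹); linarith) (two_pos.trans_le hp)
    (one_pos.trans_le hq) hR hCδ hκ
  exact ⟨c, hc, fun m n ε δ D hε hδ hD hsum hδC =>
    le_iInf fun P => h m n ε δ D hε hδ hD hsum hδC P⟩
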